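/- **Setting.** Let $\mathcal T\subset\mathbb R$ be compact, let $K$ be a continuous reproducing kernel on $\mathcal T$ with RKHS $\mathcal H(K)$ and norm $\|\cdot\|_K$, and write $L^2=L^2(\mathcal T)$. There is a target task $l=0$ and there are finitely many source tasks $l=1,\dots,L$, with $$Y_i^{(l)}=\langle X_i^{(l)},\beta^{(l)}\rangle_{L^2}+\epsilon_i^{(l)},\qquad i=1,\dots,n_l,\qquad \beta^{(l)}\in\mathcal H(K).$$ All pairs $(X_i^{(l)},\epsilon_i^{(l)})$ are independent and, within a task, identically distributed; $\epsilon_i^{(l)}$ is independent of $X_i^{(l)}$, centred, with finite variance; the $X_i^{(l)}$ are centred random elements of $L^2$ with $\mathbb E\|X^{(l)}\|_{L^2}^2<\infty$ and bounded kurtosis, i.e. for some constant $c$, $\mathbb E\langle X^{(l)},f\rangle^4\le c\,(\mathbb E\langle X^{(l)},f\rangle^2)^2$ for all $f\in L^2$. Let $L_K$ and $L_{C^{(l)}}$ be the integral operators on $L^2$ of $K$ and of the covariance function of $X^{(l)}$, let $L_{K^{1/2}}$ be the positive square root of $L_K$, and $L_{T^{(l)}}=L_{K^{1/2}}L_{C^{(l)}}L_{K^{1/2}}$.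 Assume that $L_{T^{(0)}}$ has an orthonormal basis $(\phi_j)_{j\ge1}$ of $L^2$ as eigenfunctions, with eigenvalues $s^{(0)}_j>0$, $s_j^{(0)}\asymp j^{-2r}$, $r>0$. Here $a_j\asymp b_j$ means that the ratio is eventually bounded above and below by positive constants. Fix a nonempty set $\mathcal S$ of sources, the coefficients $\beta^{(l)}$, $l\in\mathcal S$, and $h\ge0$. Put $\mathcal S^*=\{0\}\cup\mathcal S$, $n_{\mathcal S}=\sum_{l\in\mathcal S}n_l$ and $\Theta(h)=\{\beta^{(0)}\in\mathcal H(K):\|\beta^{(0)}-\beta^{(l)}\|_K\le h\ \ \forall l\in\mathcal S\}$. TL-FLR computes $$\hat\beta_{\mathcal S}=\operatorname*{argmin}_{\beta\in\mathcal H(K)}\frac1{n_{\mathcal S}+n_0}\sum_{l\in\mathcal S^*}\sum_{i=1}^{n_l}\bigl(Y_i^{(l)}-\langle X_i^{(l)},\beta\rangle\bigr)^2+\lambda_1\|\beta\|_K^2,$$ $$\hat\beta_\delta=\operatorname*{argmin}_{\beta\in\mathcal H(K)}\frac1{n_0}\sum_{i=1}^{n_0}\bigl(Y_i^{(0)}-\langle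 X_i^{(0)},\hat\beta_{\mathcal S}+\beta\rangle\bigr)^2+\lambda_2\|\beta\|_K^2,$$ with $\lambda_1,\lambda_2>0$, and returns $\hat\beta=\hat\beta_{\mathcal S}+\hat\beta_\delta$. Its excess risk is $\mathcal E(\hat\beta)=\mathbb E\bigl[\langle X^{(0)},\hat\beta-\beta^{(0)}\rangle^2\mid\text{data}\bigr]$ for a new target curve $X^{(0)}$ independent of the data. The population limit of the first step is $\beta_{\mathcal S}=L_{K^{1/2}}f_{\mathcal S}\in\mathcal H(K)$, where, with $\alpha_l=n_l/(n_{\mathcal S}+n_0)$ and $\beta^{(l)}=L_{K^{1/2}}f_l$, $$\sum_{l\in\mathcal S^*}\alpha_lL_{T^{(l)}}f_{\mathcal S}=\sum_{l\in\mathcal S^*}\alpha_lL_{T^{(l)}}f_l .$$ **Theorem (upper bound).** Consider a sequence of sample sizes with $n_0\ge 1$, $n_{\mathcal S}\ge1$, $n_0\to\infty$ and $n_0/n_{\mathcal S}$ bounded away from $0$. Assume one of the following. 1. The operators $L_{T^{(l)}}$, $l\in\mathcal S^*$, commute, and for each $l\in\mathcal S$ there is a constant $c_l$ with $\langle L_{T^{(l)}}\phi_j,\phi_j\rangle\le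 c_l\,s_j^{(0)}$ for all $j$. 2. For each $l\in\mathcal S$ the operator $\mathbf I-(L_{T^{(0)}})^{-1/2}L_{T^{(l)}}(L_{T^{(0)}})^{-1/2}$ is Hilbert–Schmidt, and $\beta_{\mathcal S}$ exists in $\mathcal H(K)$ with $\|\beta_{\mathcal S}\|_K$ bounded uniformly over $\beta^{(0)}\in\Theta(h)$ and over the sequence. Let $\lambda_1\asymp n_{\mathcal S}^{-2r/(2r+1)}$, $\lambda_2\asymp n_0^{-2r/(2r+1)}$. Then $\beta_{\mathcal S}$ exists in $\mathcal H(K)$ for all $\beta^{(0)}\in\Theta(h)$, the TL-FLR estimator exists and is unique, and, with $\xi(h,\mathcal S)=(h/\|\beta_{\mathcal S}\|_K)^{2/(2r+1)}$, $$\mathcal E(\hat\beta)=O_P\Bigl((n_{\mathcal S}+n_0)^{-\frac{2r}{2r+1}}+n_0^{-\frac{2r}{2r+1}}\,\xi(h,\mathcal S)\Bigr)$$ uniformly over $\beta^{(0)}\in\Theta(h)$: for every $\delta>0$ there is $M$ such that, for every term of the sequence, with probability at least $1-\delta$ the excess risk is at most $M$ times the rate simultaneously for all $\beta^{(0)}\in\Theta(h)$.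 -/

import Mathlib

open MeasureTheory ProbabilityTheory Filter Topology Asymptotics
open scoped RealInnerProductSpace

namespace TLFLR

noncomputable section

/-- Lebesgue measure on `𝒯 ⊆ ℝ`. -/
abbrev leb (𝒯 : Set ℝ) : Measure 𝒯 := Measure.comap Subtype.val volume

/-- The real Hilbert space `L²(𝒯)` with respect to Lebesgue measure on `𝒯 ⊆ ℝ`. -/
abbrev L2 (𝒯 : Set ℝ) : Type := Lp ℝ 2 (leb 𝒯)

instance (𝒯 : Set ℝ) : MeasurableSpace (L2 𝒯) := borel _

instance (𝒯 : Set ℝ) : BorelSpace (L2 𝒯) := ⟨rfl⟩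

/-! ### Operators on `L²(𝒯)` -/

/-- `L` is the integral operator `f ↦ ∫ Γ(·, t) f(t) dt` of the kernel `Γ`. -/
def IsIntegralOp {𝒯 : Set ℝ} (Γ : 𝒯 → 𝒯 → ℝ) (L : L2 𝒯 →L[ℝ] L2 𝒯) : Prop :=
  ∀ f : L2 𝒯, (L f : 𝒯 → ℝ) =ᵐ[leb 𝒯] fun s => ∫ t, Γ s t * f t ∂leb 𝒯

/-- On a compact set, every continuous kernel defines an integral operator. -/
theorem exists_isIntegralOp_of_continuous {𝒯 : Set ℝ} (h𝒯 : IsCompact 𝒯) (Γ : 𝒯 → 𝒯 → ℝ)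
    (hΓ : Continuous fun p : 𝒯 × 𝒯 => Γ p.1 p.2) : ∃ L, IsIntegralOp Γ L := by
  have : CompactSpace 𝒯 := isCompact_iff_compactSpace.mp h𝒯
  have : IsFiniteMeasure (leb 𝒯) := by
    constructor
    rw [Measure.comap_apply _ Subtype.val_injective
      (fun s hs => h𝒯.measurableSet.subtype_image hs) _ MeasurableSet.univ]
    simpa using h𝒯.measure_lt_top
  obtain ⟨M, hM⟩ : ∃ M, ∀ p : 𝒯 × 𝒯, ‖Γ p.1 p.2‖ ≤ M := by
    obtain ⟨M, hM⟩ := (isCompact_range hΓ).isBounded.exists_norm_le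
    exact ⟨M, fun p => hM _ ⟨p, rfl⟩⟩
  have hf1 : ∀ f : L2 𝒯, Integrable f (leb 𝒯) := fun f =>
    (Lp.memLp f).integrable (by norm_num)
  have hint : ∀ (f : L2 𝒯) (s : 𝒯), Integrable (fun t => Γ s t * f t) (leb 𝒯) := fun f s =>
    (hf1 f).bdd_mul (c := M)
      (by exact (hΓ.comp (Continuous.prodMk_right s)).aestronglyMeasurable)
      (Eventually.of_forall fun t => hM (s, t))
  have hcont : ∀ f : L2 𝒯, Continuous fun s => ∫ t, Γ s t * f t ∂leb 𝒯 := fun f =>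
    continuous_of_dominated (bound := fun t => M * ‖f t‖)
      (fun s => (hint f s).aestronglyMeasurable)
      (fun s => Eventually.of_forall fun t => by
        rw [norm_mul]; exact mul_le_mul_of_nonneg_right (hM (s, t)) (norm_nonneg _))
      ((hf1 f).norm.const_mul M)
      (Eventually.of_forall fun t => by
        exact (hΓ.comp (Continuous.prodMk_left t)).mul continuous_const)
  let C : L2 𝒯 → C(𝒯, ℝ) := fun f => ⟨_, hcont f⟩
  let A : L2 𝒯 →ₗ[ℝ] C(𝒯, ℝ) :=
    { toFun := C
      map_add' := fun f g => by
        ext s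
        simp only [C, ContinuousMap.coe_mk, ContinuousMap.add_apply]
        rw [← integral_add (hint f s) (hint g s)]
        refine integral_congr_ae ?_
        filter_upwards [Lp.coeFn_add f g] with t ht
        rw [ht, Pi.add_apply, mul_add]
      map_smul' := fun c f => by
        ext s
        simp only [C, ContinuousMap.coe_mk, ContinuousMap.smul_apply, RingHom.id_apply,
          smul_eq_mul]
        rw [← integral_const_mul]
        refine integral_congr_ae ?_
        filter_upwards [Lp.coeFn_smul c f] with t ht
        rw [ht, Pi.smul_apply, smul_eq_mul, mul_left_comm] }
  have hM0 : ∀ s : 𝒯, 0 ≤ M := fun s => (norm_nonneg _).trans (hM (s, s))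
  let B : L2 𝒯 →L[ℝ] C(𝒯, ℝ) := A.mkContinuous
    (|M| * (leb 𝒯).real Set.univ ^ ((1 : ℝ) - 1 / 2)) fun f => by
      refine (ContinuousMap.norm_le _ (by positivity)).2 fun s => ?_
      have h1 : ‖∫ t, Γ s t * f t ∂leb 𝒯‖ ≤ ∫ t, |M| * ‖f t‖ ∂leb 𝒯 :=
        norm_integral_le_of_norm_le ((hf1 f).norm.const_mul _) (Eventually.of_forall fun t => by
          rw [norm_mul]
          exact mul_le_mul_of_nonneg_right ((hM (s, t)).trans (le_abs_self M)) (norm_nonneg _))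
      have h2 : ∫ t, ‖f t‖ ∂leb 𝒯 ≤ (leb 𝒯).real Set.univ ^ ((1 : ℝ) - 1 / 2) * ‖f‖ := by
        have h3 := eLpNorm_le_eLpNorm_mul_rpow_measure_univ (p := 1) (q := 2) (μ := leb 𝒯)
          (by norm_num) (Lp.aestronglyMeasurable f)
        rw [integral_norm_eq_lintegral_enorm (Lp.aestronglyMeasurable f), ← eLpNorm_one_eq_lintegral_enorm,
          Lp.norm_def]
        have hfin : eLpNorm f 2 (leb 𝒯) ≠ ⊤ := (Lp.memLp f).2.ne
        have := ENNReal.toReal_mono (ENNReal.mul_ne_top hfin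
          (ENNReal.rpow_ne_top_of_nonneg (by norm_num) (measure_ne_top _ _))) h3
        rw [ENNReal.toReal_mul, ← ENNReal.toReal_rpow] at this
        simpa [mul_comm, Measure.real] using this
      calc ‖∫ t, Γ s t * f t ∂leb 𝒯‖ ≤ |M| * ∫ t, ‖f t‖ ∂leb 𝒯 := by
            rwa [integral_const_mul] at h1
        _ ≤ _ := by
            rw [mul_assoc]; exact mul_le_mul_of_nonneg_left h2 (abs_nonneg _)
  refine ⟨(ContinuousMap.toLp 2 (leb 𝒯) ℝ) ∘L B, fun f => ?_⟩
  exact ContinuousMap.coeFn_toLp (leb 𝒯) (C f)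

open scoped Classical in
/-- The integral operator `L_Γ` (and `0` if `Γ` does not define a bounded operator on `L²(𝒯)`;
this does not happen for continuous kernels on compact sets, see
`exists_isIntegralOp_of_continuous`). -/
def integralOp {𝒯 : Set ℝ} (Γ : 𝒯 → 𝒯 → ℝ) : L2 𝒯 →L[ℝ] L2 𝒯 :=
  if h : ∃ L, IsIntegralOp Γ L then h.choose else 0

open scoped Classical in
/-- The square root of a positive bounded operator `A`: the (unique) positive `R` with `R² = A`;
`0` if `A` has none, that is, if `A` is not positive. -/
def opSqrt {E : Type*} [NormedAddCommGroup E] [InnerProductSpace ℝ E] [CompleteSpace E]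
    (A : E →L[ℝ] E) : E →L[ℝ] E :=
  if h : ∃ R : E →L[ℝ] E, R.IsPositive ∧ R ∘L R = A then h.choose else 0

/-- Hilbert–Schmidt operators: `∑ ‖A bᵢ‖² < ∞` for some orthonormal basis `b`
(equivalently, for all of them). -/
def IsHilbertSchmidt {E : Type*} [NormedAddCommGroup E] [InnerProductSpace ℝ E]
    (A : E →L[ℝ] E) : Prop :=
  ∃ (w : Set E) (b : HilbertBasis w ℝ E), Summable fun i => ‖A (b i)‖ ^ 2

/-- The covariance operator `L_C` of a law `ν` on `L²(𝒯)`: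
`⟪L_C f, g⟫ = E[⟪f, X - E X⟫ ⟪g, X - E X⟫]` for `X ∼ ν`. It is the integral operator of the
covariance function `C(s,t) = Cov(X(s), X(t))`. -/
def covOp {𝒯 : Set ℝ} (ν : Measure (L2 𝒯)) : L2 𝒯 →L[ℝ] L2 𝒯 :=
  InnerProductSpace.continuousLinearMapOfBilin (𝕜 := ℝ) (covarianceBilin ν)

section RKHS

variable {𝒯 : Set ℝ} (H : Type*) [NormedAddCommGroup H] [InnerProductSpace ℝ H]
  [RKHS ℝ H 𝒯 ℝ]

/-- The scalar reproducing kernel `K(s,t)` of the RKHS `H = ℋ(K)` of real functions on `𝒯`. -/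
def scalarKernel [CompleteSpace H] (s t : 𝒯) : ℝ := RKHS.kernel H s t 1

/-- `L_{K^{1/2}}`, the positive square root of `L_K`. -/
def sqrtK [CompleteSpace H] : L2 𝒯 →L[ℝ] L2 𝒯 := opSqrt (integralOp (scalarKernel H))

/-- `L_T = L_{K^{1/2}} L_C L_{K^{1/2}}`, where `C` is the covariance of the law `ν`. -/
def opT [CompleteSpace H] (ν : Measure (L2 𝒯)) : L2 𝒯 →L[ℝ] L2 𝒯 :=
  sqrtK H ∘L covOp ν ∘L sqrtK H

variable {H}

/-- `⟨x, β⟩_{L²} = ∫ x(t) β(t) dt` for `x ∈ L²(𝒯)` and `β ∈ ℋ(K)`. -/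
def pairing (x : L2 𝒯) (β : H) : ℝ := ∫ t, x t * β t ∂leb 𝒯

open scoped Classical in
/-- The class in `L²(𝒯)` of the function `β ∈ ℋ(K)` (always square integrable when `𝒯` is compact
and `K` is continuous). -/
def toL2 (β : H) : L2 𝒯 := if h : MemLp (β : 𝒯 → ℝ) 2 (leb 𝒯) then h.toLp else 0

end RKHS

/-! ### Data and model. Task `0` is the target, tasks `1, …, L` are sources. -/

/-- The curves `X_i^{(l)}` and noises `ε_i^{(l)}`: all pairs `(X_i^{(l)}, ε_i^{(l)})` are
independent, identically distributed within each task, noise and curve are independent, the noise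
is centred with finite variance, and the curves are centred, square integrable and have
one-dimensional projections of uniformly bounded kurtosis. -/
structure IsSample {Ω : Type*} [MeasurableSpace Ω] {𝒯 : Set ℝ} {L : ℕ} (P : Measure Ω)
    (X : Fin (L + 1) → ℕ → Ω → L2 𝒯) (ε : Fin (L + 1) → ℕ → Ω → ℝ) : Prop where
  aemeasurable_X : ∀ l i, AEMeasurable (X l i) P
  aemeasurable_noise : ∀ l i, AEMeasurable (ε l i) P
  indep : iIndepFun (fun (p : Fin (L + 1) × ℕ) ω => (X p.1 p.2 ω, ε p.1 p.2 ω)) P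
  indep_noise : ∀ l i, IndepFun (X l i) (ε l i) P
  identDistrib_X : ∀ l i, IdentDistrib (X l i) (X l 0) P P
  identDistrib_noise : ∀ l i, IdentDistrib (ε l i) (ε l 0) P P
  memLp_X : ∀ l, MemLp (X l 0) 2 P
  mean_X : ∀ l, ∫ ω, X l 0 ω ∂P = 0
  kurtosis : ∃ c : ℝ, ∀ l, ∀ f : L2 𝒯, Integrable (fun ω => ⟪f, X l 0 ω⟫ ^ 4) P ∧
    ∫ ω, ⟪f, X l 0 ω⟫ ^ 4 ∂P ≤ c * (∫ ω, ⟪f, X l 0 ω⟫ ^ 2 ∂P) ^ 2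
  memLp_noise : ∀ l, MemLp (ε l 0) 2 P
  mean_noise : ∀ l, ∫ ω, ε l 0 ω ∂P = 0

section Estimator

variable {𝒯 : Set ℝ} {H : Type*} [NormedAddCommGroup H] [InnerProductSpace ℝ H]
  [RKHS ℝ H 𝒯 ℝ] {L : ℕ}

/-- `n_A = ∑_{l ∈ A} n_l`. -/
def size (n : Fin (L + 1) → ℕ) (A : Finset (Fin (L + 1))) : ℕ := ∑ l ∈ A, n l

/-- Objective of the transfer step: penalized least squares over the pooled data of
`S* = {0} ∪ S`. -/
def transferLoss (x : Fin (L + 1) → ℕ → L2 𝒯) (y : Fin (L + 1) → ℕ → ℝ)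
    (n : Fin (L + 1) → ℕ) (S : Finset (Fin (L + 1))) (lam : ℝ) (β : H) : ℝ :=
  (1 / (size n (insert 0 S) : ℝ)) *
      ∑ l ∈ insert 0 S, ∑ i ∈ Finset.range (n l), (y l i - pairing (x l i) β) ^ 2
    + lam * ‖β‖ ^ 2

/-- Objective of the debias step, given the output `βS` of the transfer step. -/
def debiasLoss (x : Fin (L + 1) → ℕ → L2 𝒯) (y : Fin (L + 1) → ℕ → ℝ)
    (n : Fin (L + 1) → ℕ) (lam : ℝ) (βS : H) (β : H) : ℝ :=
  (1 / (n 0 : ℝ)) * ∑ i ∈ Finset.range (n 0), (y 0 i - pairing (x 0 i) (βS + β)) ^ 2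
    + lam * ‖β‖ ^ 2

/-- `p = (β̂_S, β̂_δ)` are the minimizers computed in the two steps of TL-FLR (all intercepts being
zero); the output of the algorithm is `β̂ = β̂_S + β̂_δ`. -/
def IsTLFLR (x : Fin (L + 1) → ℕ → L2 𝒯) (y : Fin (L + 1) → ℕ → ℝ)
    (n : Fin (L + 1) → ℕ) (S : Finset (Fin (L + 1))) (lam1 lam2 : ℝ) (p : H × H) : Prop :=
  IsMinOn (transferLoss x y n S lam1) Set.univ p.1 ∧
    IsMinOn (debiasLoss x y n lam2 p.1) Set.univ p.2

/-- Coefficient functions of all tasks: `b` for the target and `β l` for the source `l`. -/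
def coeffs (β : Fin (L + 1) → H) (b : H) : Fin (L + 1) → H := Function.update β 0 b

/-- Responses `Y_i^{(l)} = ⟨X_i^{(l)}, β^{(l)}⟩ + ε_i^{(l)}` when the target coefficient is `b`. -/
def response (β : Fin (L + 1) → H) (b : H) (x : Fin (L + 1) → ℕ → L2 𝒯)
    (e : Fin (L + 1) → ℕ → ℝ) (l : Fin (L + 1)) (i : ℕ) : ℝ :=
  pairing (x l i) (coeffs β b l) + e l i

/-- The parameter set `Θ(h)`: target coefficients within `ℋ(K)`-distance `h` of every source
coefficient `β l`, `l ∈ S`. -/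
def Theta (β : Fin (L + 1) → H) (S : Finset (Fin (L + 1))) (h : ℝ) : Set H :=
  {b | ∀ l ∈ S, ‖b - β l‖ ≤ h}

/-- Excess risk of `βhat` when the target coefficient is `b` and a new target curve has law `ν`. -/
def excessRisk (ν : Measure (L2 𝒯)) (b βhat : H) : ℝ :=
  ∫ x, (pairing x βhat - pairing x b) ^ 2 ∂ν

/-- `βS` is the population limit `β_S` of the transfer step for target coefficient `b`, sample sizes
`n` and curve laws `ν l`: writing `β = L_{K^{1/2}} f`, this is
`(∑ α_l L_{T^{(l)}}) f_S = ∑ α_l L_{T^{(l)}} f_l`, with sums over `S* = {0} ∪ S` and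
`α_l = n_l / n_{S*}`. -/
def IsTransferLimit [CompleteSpace H] (ν : Fin (L + 1) → Measure (L2 𝒯)) (β : Fin (L + 1) → H)
    (b : H) (n : Fin (L + 1) → ℕ) (S : Finset (Fin (L + 1))) (βS : H) : Prop :=
  ∑ l ∈ insert 0 S, ((n l : ℝ) / size n (insert 0 S)) • sqrtK H (covOp (ν l) (toL2 βS)) =
    ∑ l ∈ insert 0 S, ((n l : ℝ) / size n (insert 0 S)) •
      sqrtK H (covOp (ν l) (toL2 (coeffs β b l)))

/-- `(n_S + n_0)^{-2r/(2r+1)} + n_0^{-2r/(2r+1)} ξ` with `ξ = (h / ‖β_S‖_K)^{2/(2r+1)}`. -/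
def rate (r h : ℝ) (n : Fin (L + 1) → ℕ) (S : Finset (Fin (L + 1))) (βS : H) : ℝ :=
  ((size n S : ℝ) + n 0) ^ (-(2 * r / (2 * r + 1))) +
    (n 0 : ℝ) ^ (-(2 * r / (2 * r + 1))) * (h / ‖βS‖) ^ (2 / (2 * r + 1))

end Estimator

/-! ### The two structural assumptions, for operators `T l` (`= L_{T^{(l)}}`) -/

section Assumptions

variable {E : Type*} [NormedAddCommGroup E] [InnerProductSpace ℝ E] {L : ℕ}

/-- The operators of the tasks in `S* = {0} ∪ S` commute, and `⟪T l φ_j, φ_j⟫ ≲ s_j`, where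
`(s_j, φ_j)` are the eigenpairs of `T 0`. -/
def CommutingAssumption (T : Fin (L + 1) → E →L[ℝ] E) (S : Finset (Fin (L + 1)))
    (φ : ℕ → E) (s : ℕ → ℝ) : Prop :=
  (∀ l ∈ insert 0 S, ∀ l' ∈ insert 0 S, Commute (T l) (T l')) ∧
    ∀ l ∈ S, ∃ c : ℝ, ∀ j, ⟪T l (φ j), φ j⟫ ≤ c * s j

/-- `I - T₀^{-1/2} T_l T₀^{-1/2}` is (extends to) a Hilbert–Schmidt operator `D` for all `l ∈ S`.
Since the inverse square root is unbounded, the identity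
`D = I - T₀^{-1/2} T_l T₀^{-1/2}` is written as `T_l = T₀^{1/2} (I - D) T₀^{1/2}`. -/
def HSAssumption [CompleteSpace E] (T : Fin (L + 1) → E →L[ℝ] E) (S : Finset (Fin (L + 1))) :
    Prop :=
  ∀ l ∈ S, ∃ D : E →L[ℝ] E, IsHilbertSchmidt D ∧
    T l = opSqrt (T 0) ∘L (ContinuousLinearMap.id ℝ E - D) ∘L opSqrt (T 0)

end Assumptions

end

end TLFLR

/-! Since `n₀/n_S` stays away from zero, the target is a fixed fraction of the pooled sample. So
`n₀^(-α)` and `(n_S + n₀)^(-α)`, with `α = 2r/(2r+1)`, are comparable along the sequence, and it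
suffices to show that the excess risk is of order `n₀^(-α)`. The `ξ` term of the rate is nonnegative
and is simply discarded at the end.

Everything is done in whitened coordinates. Injectivity of `L_{K^{1/2}}` lets each `β` be written
`L_{K^{1/2}} (V β)` with a coisometry `V` (`exists_coisometry`). Then `⟨X, β⟩ = ⟪Z, V β⟫` with `Z =
L_{K^{1/2}} X`, whose second moment operator is `L_T`. Both steps of TL-FLR become ridge regressions
with normal equations of the same shape, the second one shrinking towards the output of the first.

Testing the normal equations with the error `d` gives a deterministic inequality for `⟪T₀ V d, V d⟫
+ λ‖d‖²` (`sqrt_ridge_error_le`). It holds as soon as empirical moments and noise are controlled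
relative to the form `T₀ + λ`. This control comes from bounded kurtosis, Markov's inequality for
weighted Hilbert–Schmidt norms, and the effective dimension `∑ s_j/(s_j+λ) ≲ λ^(-1/(2r))`. It holds
for all test vectors at once, which yields uniformity over `Θ(h)`.

From the pooled step one needs only that its output stays within bounded `ℋ(K)`-distance of `β_S`;
the debias step then has risk of order `λ₂`. Under the commuting assumption a bounded `β_S` exists
because products of commuting positive operators are positive, so each `T_l` is dominated in norm by
the sum and Douglas' lemma applies. -/

namespace TLFLR

/-! ### Hilbert space tools: factorization, commuting positive operators, weighted Cauchy–Schwarz.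
-/

section Hilbert

variable {E F G : Type*} [NormedAddCommGroup E] [InnerProductSpace ℝ E]
  [NormedAddCommGroup F] [InnerProductSpace ℝ F]
  [NormedAddCommGroup G] [InnerProductSpace ℝ G]

/-- A form of Douglas' factorization lemma. -/
theorem exists_inner_eq_of_norm_le [CompleteSpace G] (A : E →ₗ[ℝ] F) (B : E →ₗ[ℝ] G)
    (hAB : ∀ x, ‖A x‖ ≤ ‖B x‖) (f : F) :
    ∃ g : G, ‖g‖ ≤ ‖f‖ ∧ ∀ x, ⟪A x, f⟫ = ⟪B x, g⟫ := by
  let ℓ : E →ₗ[ℝ] ℝ := (innerₛₗ ℝ f) ∘ₗ A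
  have hker : LinearMap.ker B ≤ LinearMap.ker ℓ := by
    intro x hx
    have h1 : A x = 0 := by
      have := hAB x
      rw [LinearMap.mem_ker.1 hx, norm_zero] at this
      exact norm_le_zero_iff.1 this
    simp [ℓ, h1]
  -- The functional `x ↦ ⟪f, A x⟫` descends to the range of `B`, where the domination bounds it by
  -- `‖f‖`. A norm-preserving Hahn–Banach extension and Riesz representation produce `g`.
  let ℓ' : LinearMap.range B →ₗ[ℝ] ℝ :=
    ((LinearMap.ker B).liftQ ℓ hker) ∘ₗ B.quotKerEquivRange.symm.toLinearMap
  have hℓ' : ∀ x, ℓ' ⟨B x, x, rfl⟩ = ⟪f, A x⟫ := by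
    intro x
    have : B.quotKerEquivRange.symm ⟨B x, x, rfl⟩ = (LinearMap.ker B).mkQ x := by
      rw [LinearEquiv.symm_apply_eq]
      rfl
    simp [ℓ', this, ℓ]
  let L := ℓ'.mkContinuous ‖f‖ (by
    rintro ⟨_, x, rfl⟩
    rw [hℓ' x]
    refine (norm_inner_le_norm f (A x)).trans ?_
    exact mul_le_mul_of_nonneg_left (hAB x) (norm_nonneg _))
  obtain ⟨g, hg, hgn⟩ := exists_extension_norm_eq (𝕜 := ℝ) _ L
  refine ⟨(InnerProductSpace.toDual ℝ G).symm g, ?_, fun x => ?_⟩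
  · rw [LinearIsometryEquiv.norm_map, hgn]
    exact LinearMap.mkContinuous_norm_le _ (norm_nonneg _) _
  · rw [real_inner_comm _ (B x), InnerProductSpace.toDual_symm_apply, real_inner_comm, ← hℓ' x]
    exact (hg ⟨B x, x, rfl⟩).symm

theorem inner_apply_self_le_of_norm_le_one (A : E →L[ℝ] E)
    (hA1 : ‖A‖ ≤ 1) (x : E) : ⟪A x, x⟫ ≤ ‖x‖ ^ 2 := by
  refine (real_inner_le_norm _ _).trans ?_
  have := A.le_of_opNorm_le hA1 x
  nlinarith [norm_nonneg x]

/-- The product of two commuting positive operators is positive. -/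
theorem inner_nonneg_of_commute_of_norm_le (A C : E →L[ℝ] E) (hA : A.IsPositive)
    (hC : C.IsPositive) (h : Commute A C) (hA1 : ‖A‖ ≤ 1) (x : E) : 0 ≤ ⟪A x, C x⟫ := by
  -- Riesz's iteration `a₀ = A`, `aₙ₊₁ = aₙ - aₙ²` telescopes to `A = ∑_{k<n} aₖ² + aₙ`. All `aₖ`
  -- commute with `C`, so `⟪A x, C x⟫` is a sum of terms `⟪aₖ x, C (aₖ x)⟫ ≥ 0` plus a remainder;
  -- the latter vanishes because `∑ ‖aₖ x‖² ≤ ⟪A x, x⟫`.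
  let a : ℕ → E →L[ℝ] E := fun n => Nat.rec A (fun _ b => b - b * b) n
  have a_succ : ∀ n, a (n + 1) = a n - a n * a n := fun n => rfl
  have inv : ∀ n, (∀ x y, ⟪a n x, y⟫ = ⟪x, a n y⟫) ∧ Commute (a n) C ∧
      (∀ x, 0 ≤ ⟪a n x, x⟫) ∧ ∀ x, ⟪a n x, x⟫ ≤ ‖x‖ ^ 2 := by
    intro n
    induction n with
    | zero =>
      exact ⟨hA.isSymmetric, h, hA.inner_nonneg_left,
        inner_apply_self_le_of_norm_le_one A hA1⟩
    | succ n ih =>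
      obtain ⟨h1, h2, h3, h4⟩ := ih
      refine ⟨fun x y => ?_, ?_, fun x => ?_, fun x => ?_⟩
      · simp only [a_succ, sub_apply, mul_apply_eq_comp,
          inner_sub_left, inner_sub_right, h1]
      · rw [a_succ]
        exact h2.sub_left (h2.mul_left h2)
      -- With `b = aₙ`, this is `b - b² = b(1-b)b + (1-b)b(1-b)`, a sum of two positive operators
      -- when `0 ≤ b ≤ 1`.
      · have e : ⟪a (n + 1) x, x⟫ = (‖a n x‖ ^ 2 - ⟪a n (a n x), a n x⟫)
            + ⟪a n (x - a n x), x - a n x⟫ := by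
          simp only [a_succ, sub_apply, mul_apply_eq_comp,
            inner_sub_left, inner_sub_right, map_sub]
          rw [← real_inner_self_eq_norm_sq, h1 (a n x) x]
          ring
        rw [e]
        have := h4 (a n x)
        have := h3 (x - a n x)
        linarith
      · have e : ⟪a (n + 1) x, x⟫ = ⟪a n x, x⟫ - ‖a n x‖ ^ 2 := by
          simp only [a_succ, sub_apply, mul_apply_eq_comp,
            inner_sub_left]
          rw [← real_inner_self_eq_norm_sq, h1 (a n x) x]
        rw [e]
        have := h4 x
        nlinarith [sq_nonneg ‖a n x‖]
  have tele : ∀ n y, ⟪A x, y⟫ = ∑ k ∈ Finset.range n, ⟪a k x, a k y⟫ + ⟪a n x, y⟫ := by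
    intro n y
    induction n with
    | zero => simp [a]
    | succ n ih =>
      rw [ih, Finset.sum_range_succ, a_succ]
      simp only [sub_apply, mul_apply_eq_comp, inner_sub_left]
      rw [(inv n).1 (a n x) y]
      ring
  have hsum : Summable fun k => ‖a k x‖ ^ 2 := by
    refine summable_of_sum_range_le (c := ⟪A x, x⟫) (fun k => sq_nonneg _) fun n => ?_
    rw [tele n x]
    have := (inv n).2.2.1 x
    simp only [real_inner_self_eq_norm_sq]
    linarith
  have hlim : Tendsto (fun n => ⟪a n x, C x⟫) atTop (𝓝 0) := by
    have h0 : Tendsto (fun n => a n x) atTop (𝓝 0) := by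
      rw [tendsto_zero_iff_norm_tendsto_zero]
      have := hsum.tendsto_atTop_zero.sqrt
      simpa [Real.sqrt_sq (norm_nonneg _)] using this
    simpa using h0.inner (tendsto_const_nhds (x := C x))
  refine le_of_tendsto' hlim fun n => ?_
  rw [tele n (C x)]
  have hterm : ∀ k, 0 ≤ ⟪a k x, a k (C x)⟫ := by
    intro k
    have e : a k (C x) = C (a k x) := by
      have := congrArg (fun T : E →L[ℝ] E => T x) (inv k).2.1.eq
      simpa using this
    rw [e]
    exact hC.inner_nonneg_right _
  linarith [Finset.sum_nonneg fun k (_ : k ∈ Finset.range n) => hterm k]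

theorem inner_nonneg_of_commute (A C : E →L[ℝ] E) (hA : A.IsPositive)
    (hC : C.IsPositive) (h : Commute A C) (x : E) : 0 ≤ ⟪A x, C x⟫ := by
  have hpos : 0 < ‖A‖ + 1 := by positivity
  have h1 := inner_nonneg_of_commute_of_norm_le ((‖A‖ + 1)⁻¹ • A) C
    (hA.smul_of_nonneg (by positivity)) hC (h.smul_left _) (by
      rw [norm_smul, norm_inv, Real.norm_of_nonneg hpos.le, inv_mul_le_iff₀ hpos]
      linarith) x
  rw [FunLike.coe_smul, Pi.smul_apply, real_inner_smul_left] at h1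
  exact nonneg_of_mul_nonneg_right h1 (by positivity)

/-- For pairwise commuting positive operators, each summand of `∑ T l` is dominated in norm. -/
theorem norm_apply_le_norm_sum_apply {ι : Type*} [DecidableEq ι] (A : Finset ι) (T : ι → E →L[ℝ] E)
    (hT : ∀ l ∈ A, (T l).IsPositive) (hc : ∀ l ∈ A, ∀ l' ∈ A, Commute (T l) (T l'))
    {l : ι} (hl : l ∈ A) (x : E) : ‖T l x‖ ≤ ‖∑ m ∈ A, T m x‖ := by
  rw [← Finset.add_sum_erase _ _ hl]
  refine le_of_sq_le_sq ?_ (norm_nonneg _)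
  rw [norm_add_sq_real, inner_sum]
  have : 0 ≤ ∑ m ∈ A.erase l, ⟪T l x, T m x⟫ := Finset.sum_nonneg fun m hm =>
    inner_nonneg_of_commute _ _ (hT l hl) (hT m (Finset.mem_of_mem_erase hm))
      (hc l hl m (Finset.mem_of_mem_erase hm)) x
  nlinarith [sq_nonneg ‖∑ m ∈ A.erase l, T m x‖]

/-- Commuting positive operators: `(∑ T l) g = ∑ T l (f l)` has a bounded solution `g`. -/
theorem exists_sum_apply_eq_of_commute [CompleteSpace E] {ι : Type*} [DecidableEq ι]
    (A : Finset ι) (T : ι → E →L[ℝ] E)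
    (hT : ∀ l ∈ A, (T l).IsPositive) (hc : ∀ l ∈ A, ∀ l' ∈ A, Commute (T l) (T l'))
    (f : ι → E) :
    ∃ g : E, ‖g‖ ≤ ∑ l ∈ A, ‖f l‖ ∧ ∑ l ∈ A, T l g = ∑ l ∈ A, T l (f l) := by
  -- Each right-hand side `T l (f l)` is solved separately by Douglas' lemma, using that `T l` is
  -- dominated by the sum; the solutions are then added.
  have key : ∀ l ∈ A, ∃ g : E, ‖g‖ ≤ ‖f l‖ ∧ ∀ x, ⟪T l x, f l⟫ = ⟪∑ m ∈ A, T m x, g⟫ := by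
    intro l hl
    obtain ⟨g, hg, h⟩ := exists_inner_eq_of_norm_le (T l : E →ₗ[ℝ] E)
      ((∑ m ∈ A, T m : E →L[ℝ] E) : E →ₗ[ℝ] E) (fun x => by
        simpa [sum_apply] using norm_apply_le_norm_sum_apply A T hT hc hl x) (f l)
    exact ⟨g, hg, fun x => by simpa [sum_apply] using h x⟩
  choose! g hg h using key
  refine ⟨∑ l ∈ A, g l, norm_sum_le_of_le _ hg, ?_⟩
  refine ext_inner_left ℝ fun x => ?_
  have h2 : ∀ y : E, ⟪x, ∑ l ∈ A, T l y⟫ = ⟪∑ l ∈ A, T l x, y⟫ := by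
    intro y
    rw [inner_sum, sum_inner]
    exact Finset.sum_congr rfl fun l hl => ((hT l hl).isSymmetric x y).symm
  rw [h2, inner_sum, inner_sum]
  refine Finset.sum_congr rfl fun l hl => ?_
  rw [← h l hl x]
  exact (hT l hl).isSymmetric x (f l)

/-- Weighted Cauchy–Schwarz inequality in an orthonormal basis. -/
theorem abs_inner_le_of_weighted {ι : Type*} (φ : HilbertBasis ι ℝ E) (w : ι → ℝ)
    (hw : ∀ j, 0 < w j) (f g : E) {a b : ℝ}
    (hf : ∀ J : Finset ι, ∑ j ∈ J, ⟪f, φ j⟫ ^ 2 / w j ≤ a)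
    (hg : ∀ J : Finset ι, ∑ j ∈ J, w j * ⟪g, φ j⟫ ^ 2 ≤ b) :
    ⟪f, g⟫ ^ 2 ≤ a * b := by
  have hlim : Tendsto (fun J : Finset ι => (∑ j ∈ J, ⟪f, φ j⟫ * ⟪φ j, g⟫) ^ 2) atTop
      (𝓝 (⟪f, g⟫ ^ 2)) := (φ.hasSum_inner_mul_inner f g).pow 2
  refine le_of_tendsto' hlim fun J => ?_
  have ha : 0 ≤ a := by simpa using hf ∅
  calc (∑ j ∈ J, ⟪f, φ j⟫ * ⟪φ j, g⟫) ^ 2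
      = (∑ j ∈ J, (⟪f, φ j⟫ / √(w j)) * (√(w j) * ⟪g, φ j⟫)) ^ 2 := by
        congr 1
        refine Finset.sum_congr rfl fun j _ => ?_
        have := (Real.sqrt_pos.2 (hw j)).ne'
        rw [real_inner_comm g]
        field_simp
    _ ≤ (∑ j ∈ J, (⟪f, φ j⟫ / √(w j)) ^ 2) * ∑ j ∈ J, (√(w j) * ⟪g, φ j⟫) ^ 2 :=
        Finset.sum_mul_sq_le_sq_mul_sq _ _ _
    _ = (∑ j ∈ J, ⟪f, φ j⟫ ^ 2 / w j) * ∑ j ∈ J, w j * ⟪g, φ j⟫ ^ 2 := by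
        simp only [div_pow, mul_pow, Real.sq_sqrt (hw _).le]
    _ ≤ a * b := mul_le_mul (hf J) (hg J)
        (Finset.sum_nonneg fun j _ => mul_nonneg (hw j).le (sq_nonneg _)) ha

/-- For an operator diagonal in `φ` with eigenvalues `s`, the partial sums of
`∑ (s j + lam) ⟪g, φ j⟫²` are at most `⟪T g, g⟫ + lam ‖g‖²`. -/
theorem sum_weighted_sq_le {ι : Type*} (φ : HilbertBasis ι ℝ E) (s : ι → ℝ) (hs : ∀ j, 0 ≤ s j)
    (T : E →L[ℝ] E) (hsymm : ∀ x y, ⟪T x, y⟫ = ⟪x, T y⟫) (hT : ∀ j, T (φ j) = s j • φ j)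
    {lam : ℝ} (hlam : 0 ≤ lam) (g : E) (J : Finset ι) :
    ∑ j ∈ J, (s j + lam) * ⟪g, φ j⟫ ^ 2 ≤ ⟪T g, g⟫ + lam * ‖g‖ ^ 2 := by
  have h1 : HasSum (fun j => (s j + lam) * ⟪g, φ j⟫ ^ 2) (⟪T g, g⟫ + lam * ‖g‖ ^ 2) := by
    have ha := φ.hasSum_inner_mul_inner (T g) g
    have hb := (φ.hasSum_inner_mul_inner g g).mul_left lam
    rw [real_inner_self_eq_norm_sq] at hb
    refine (ha.add hb).congr_fun ?_
    intro j
    rw [hsymm, hT, real_inner_smul_right, real_inner_comm g (φ j)]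
    ring
  exact sum_le_hasSum J (fun j _ => mul_nonneg (add_nonneg (hs j) hlam) (sq_nonneg _)) h1

/-! ### Penalized least squares -/

/-- The penalized least squares objective. -/
noncomputable def ridgeLoss {ι : Type*} (J : Finset ι) (v : ι → E) (y : ι → ℝ) (w lam : ℝ)
    (β : E) : ℝ :=
  w * ∑ i ∈ J, (y i - ⟪v i, β⟫) ^ 2 + lam * ‖β‖ ^ 2

/-- The normal equations of the penalized least squares problem. -/
def IsRidgeSolution {ι : Type*} (J : Finset ι) (v : ι → E) (y : ι → ℝ) (w lam : ℝ)
    (β : E) : Prop :=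
  ∀ γ, w * ∑ i ∈ J, (y i - ⟪v i, β⟫) * ⟪v i, γ⟫ = lam * ⟪β, γ⟫

/-- The penalty makes the normal operator coercive with constant `lam`, hence invertible. -/
theorem exists_isRidgeSolution [CompleteSpace E] {ι : Type*} (J : Finset ι) (v : ι → E)
    (y : ι → ℝ) {w lam : ℝ} (hw : 0 ≤ w) (hlam : 0 < lam) :
    ∃ β, IsRidgeSolution J v y w lam β := by
  let A : E →L[ℝ] E := w • ∑ i ∈ J, (innerSL ℝ (v i)).smulRight (v i) +
    lam • ContinuousLinearMap.id ℝ E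
  have hA : ∀ x γ, ⟪A x, γ⟫ = w * ∑ i ∈ J, ⟪v i, x⟫ * ⟪v i, γ⟫ + lam * ⟪x, γ⟫ := by
    intro x γ
    simp [A, inner_add_left, real_inner_smul_left, sum_apply, sum_inner]
  have hu : IsUnit A := by
    refine ContinuousLinearMap.isUnit_of_forall_le_norm_inner_map A (c := ⟨lam, hlam.le⟩)
      hlam fun x => ?_
    rw [hA, real_inner_self_eq_norm_sq]
    refine le_trans ?_ (le_abs_self _)
    have : 0 ≤ w * ∑ i ∈ J, ⟪v i, x⟫ * ⟪v i, x⟫ :=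
      mul_nonneg hw (Finset.sum_nonneg fun i _ => mul_self_nonneg _)
    show ‖x‖ ^ 2 * lam ≤ _
    linarith
  obtain ⟨B, hB⟩ := hu.exists_right_inv
  refine ⟨B (w • ∑ i ∈ J, y i • v i), fun γ => ?_⟩
  have h1 : A (B (w • ∑ i ∈ J, y i • v i)) = w • ∑ i ∈ J, y i • v i := by
    have := congrArg (fun T : E →L[ℝ] E => T (w • ∑ i ∈ J, y i • v i)) hB
    simpa using this
  have h2 := hA (B (w • ∑ i ∈ J, y i • v i)) γ
  rw [h1, real_inner_smul_left, sum_inner] at h2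
  simp only [real_inner_smul_left, sub_mul, Finset.sum_sub_distrib] at h2 ⊢
  linarith

/-- The normal equations cancel the linear term of the expansion around `β`. The surviving quadratic
part is at least `lam ‖γ - β‖²`, which gives both minimality and uniqueness. -/
theorem IsRidgeSolution.ridgeLoss_eq {ι : Type*} {J : Finset ι} {v : ι → E} {y : ι → ℝ}
    {w lam : ℝ} {β : E} (h : IsRidgeSolution J v y w lam β) (γ : E) :
    ridgeLoss J v y w lam γ =
      ridgeLoss J v y w lam β + (w * ∑ i ∈ J, ⟪v i, γ - β⟫ ^ 2 + lam * ‖γ - β‖ ^ 2) := by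
  have h1 := h (γ - β)
  have h2 : ∑ i ∈ J, (y i - ⟪v i, γ⟫) ^ 2 = ∑ i ∈ J, (y i - ⟪v i, β⟫) ^ 2
      - 2 * ∑ i ∈ J, (y i - ⟪v i, β⟫) * ⟪v i, γ - β⟫ + ∑ i ∈ J, ⟪v i, γ - β⟫ ^ 2 := by
    rw [Finset.mul_sum, ← Finset.sum_sub_distrib, ← Finset.sum_add_distrib]
    refine Finset.sum_congr rfl fun i _ => ?_
    rw [inner_sub_right]
    ring
  have h3 : ‖γ‖ ^ 2 = ‖β‖ ^ 2 + 2 * ⟪β, γ - β⟫ + ‖γ - β‖ ^ 2 := by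
    rw [← norm_add_sq_real, add_sub_cancel]
  rw [ridgeLoss, ridgeLoss, h2, h3]
  linear_combination (-2) * h1

theorem IsRidgeSolution.isMinOn_iff {ι : Type*} {J : Finset ι} {v : ι → E} {y : ι → ℝ}
    {w lam : ℝ} (hw : 0 ≤ w) (hlam : 0 < lam) {β : E} (h : IsRidgeSolution J v y w lam β) (γ : E) :
    IsMinOn (ridgeLoss J v y w lam) Set.univ γ ↔ γ = β := by
  constructor
  · intro hm
    have h1 := hm (Set.mem_univ β)
    simp only [Set.mem_ofPred_eq, h.ridgeLoss_eq γ] at h1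
    have h2 : 0 ≤ w * ∑ i ∈ J, ⟪v i, γ - β⟫ ^ 2 :=
      mul_nonneg hw (Finset.sum_nonneg fun i _ => sq_nonneg _)
    have h3 : lam * ‖γ - β‖ ^ 2 ≤ 0 := by linarith
    have h4 : ‖γ - β‖ ^ 2 ≤ 0 := nonpos_of_mul_nonpos_right h3 hlam
    have h5 : ‖γ - β‖ = 0 := by
      have := sq_nonneg ‖γ - β‖
      exact pow_eq_zero_iff two_ne_zero |>.1 (le_antisymm h4 this)
    exact sub_eq_zero.1 (norm_eq_zero.1 h5)
  · rintro rfl δ -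
    simp only [Set.mem_ofPred_eq, h.ridgeLoss_eq δ]
    have h2 : 0 ≤ w * ∑ i ∈ J, ⟪v i, δ - γ⟫ ^ 2 :=
      mul_nonneg hw (Finset.sum_nonneg fun i _ => sq_nonneg _)
    have h3 : 0 ≤ lam * ‖δ - γ‖ ^ 2 := by positivity
    linarith

theorem existsUnique_isMinOn_ridgeLoss [CompleteSpace E] {ι : Type*} (J : Finset ι) (v : ι → E)
    (y : ι → ℝ) {w lam : ℝ} (hw : 0 ≤ w) (hlam : 0 < lam) :
    ∃! β, IsMinOn (ridgeLoss J v y w lam) Set.univ β := by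
  obtain ⟨β, hβ⟩ := exists_isRidgeSolution J v y hw hlam
  exact ⟨β, (hβ.isMinOn_iff hw hlam β).2 rfl, fun γ hγ => (hβ.isMinOn_iff hw hlam γ).1 hγ⟩

theorem isRidgeSolution_of_isMinOn [CompleteSpace E] {ι : Type*} {J : Finset ι} {v : ι → E}
    {y : ι → ℝ} {w lam : ℝ} (hw : 0 ≤ w) (hlam : 0 < lam) {β : E}
    (hβ : IsMinOn (ridgeLoss J v y w lam) Set.univ β) : IsRidgeSolution J v y w lam β := by
  obtain ⟨β', hβ'⟩ := exists_isRidgeSolution J v y hw hlam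
  rwa [(hβ'.isMinOn_iff hw hlam β).1 hβ]

end Hilbert

/-! ### The embedding of the RKHS into `L²` and the whitening coisometry. -/

section Embedding

variable {𝒯 : Set ℝ} {H : Type*} [NormedAddCommGroup H] [InnerProductSpace ℝ H]
  [CompleteSpace H] [RKHS ℝ H 𝒯 ℝ]

theorem isFiniteMeasure_leb (h𝒯 : IsCompact 𝒯) : IsFiniteMeasure (leb 𝒯) := by
  constructor
  rw [Measure.comap_apply _ Subtype.val_injective
    (fun s hs => h𝒯.measurableSet.subtype_image hs) _ MeasurableSet.univ]
  simpa using h𝒯.measure_lt_top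

theorem inner_kerFun_one (s : 𝒯) (β : H) : ⟪RKHS.kerFun H s 1, β⟫ = β s := by
  simp

theorem inner_kerFun_kerFun (s t : 𝒯) :
    ⟪RKHS.kerFun H s 1, RKHS.kerFun H t 1⟫ = scalarKernel H s t := by
  rw [inner_kerFun_one, RKHS.kerFun_apply, scalarKernel]

/-- The squared distance of two kernel sections is `K(t,t) - 2K(t,s) + K(s,s)`, which tends to zero
as `t → s`. -/
theorem continuous_kerFun (hK : Continuous fun p : 𝒯 × 𝒯 => scalarKernel H p.1 p.2) :
    Continuous fun s : 𝒯 => RKHS.kerFun H s (1 : ℝ) := by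
  refine continuous_iff_continuousAt.2 fun s => ?_
  rw [ContinuousAt, tendsto_iff_norm_sub_tendsto_zero]
  have e : ∀ t : 𝒯, ‖RKHS.kerFun H t (1 : ℝ) - RKHS.kerFun H s 1‖ =
      √(scalarKernel H t t - 2 * scalarKernel H t s + scalarKernel H s s) := by
    intro t
    rw [← Real.sqrt_sq (norm_nonneg (RKHS.kerFun H t (1 : ℝ) - RKHS.kerFun H s 1)),
      norm_sub_sq_real, ← real_inner_self_eq_norm_sq, ← real_inner_self_eq_norm_sq]
    simp only [inner_kerFun_kerFun]
  simp only [e]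
  have gen : ∀ Γ : 𝒯 → 𝒯 → ℝ, Continuous (fun p : 𝒯 × 𝒯 => Γ p.1 p.2) →
      Continuous fun t => √(Γ t t - 2 * Γ t s + Γ s s) := by
    intro Γ hΓ
    have h1 : Continuous fun t => Γ t t := hΓ.comp (continuous_id.prodMk continuous_id)
    have h2 : Continuous fun t => Γ t s := hΓ.comp (continuous_id.prodMk continuous_const)
    fun_prop
  have hc := gen _ hK
  have h0 : √(scalarKernel H s s - 2 * scalarKernel H s s + scalarKernel H s s) = 0 := by
    rw [two_mul, sub_add_cancel_left, neg_add_cancel, Real.sqrt_zero]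
  rw [← h0]
  exact hc.tendsto s

theorem continuous_coe (hK : Continuous fun p : 𝒯 × 𝒯 => scalarKernel H p.1 p.2) (β : H) :
    Continuous (β : 𝒯 → ℝ) := by
  have h := (continuous_kerFun hK).inner (𝕜 := ℝ) (continuous_const (y := β))
  simpa only [inner_kerFun_one] using h

theorem exists_norm_kerFun_le (h𝒯 : IsCompact 𝒯)
    (hK : Continuous fun p : 𝒯 × 𝒯 => scalarKernel H p.1 p.2) :
    ∃ M, 0 ≤ M ∧ ∀ s : 𝒯, ‖RKHS.kerFun H s (1 : ℝ)‖ ≤ M := by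
  have : CompactSpace 𝒯 := isCompact_iff_compactSpace.mp h𝒯
  obtain ⟨M, hM⟩ := (isCompact_range (continuous_kerFun hK)).isBounded.exists_norm_le
  exact ⟨max M 0, le_max_right _ _, fun s => (hM _ ⟨s, rfl⟩).trans (le_max_left _ _)⟩

theorem memLp_coe (h𝒯 : IsCompact 𝒯)
    (hK : Continuous fun p : 𝒯 × 𝒯 => scalarKernel H p.1 p.2) (β : H) :
    MemLp (β : 𝒯 → ℝ) 2 (leb 𝒯) := by
  have := isFiniteMeasure_leb h𝒯
  obtain ⟨M, -, hM⟩ := exists_norm_kerFun_le h𝒯 hK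
  refine MemLp.of_bound (continuous_coe hK β).aestronglyMeasurable (M * ‖β‖)
    (Eventually.of_forall fun s => ?_)
  rw [← inner_kerFun_one]
  exact (norm_inner_le_norm _ _).trans (mul_le_mul_of_nonneg_right (hM s) (norm_nonneg _))

theorem coeFn_toL2 (h𝒯 : IsCompact 𝒯)
    (hK : Continuous fun p : 𝒯 × 𝒯 => scalarKernel H p.1 p.2) (β : H) :
    (toL2 β : 𝒯 → ℝ) =ᵐ[leb 𝒯] β := by
  rw [toL2, dif_pos (memLp_coe h𝒯 hK β)]
  exact MemLp.coeFn_toLp _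

theorem pairing_eq_inner (h𝒯 : IsCompact 𝒯)
    (hK : Continuous fun p : 𝒯 × 𝒯 => scalarKernel H p.1 p.2) (x : L2 𝒯) (β : H) :
    pairing x β = ⟪x, toL2 β⟫ := by
  rw [pairing, L2.inner_def]
  refine integral_congr_ae ?_
  filter_upwards [coeFn_toL2 h𝒯 hK β] with t ht
  simp [ht, mul_comm]

/-- The embedding of the reproducing kernel Hilbert space into `L²`. -/
theorem exists_embedding (h𝒯 : IsCompact 𝒯)
    (hK : Continuous fun p : 𝒯 × 𝒯 => scalarKernel H p.1 p.2) :
    ∃ ι : H →L[ℝ] L2 𝒯, ∀ β, ι β = toL2 β := by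
  have := isFiniteMeasure_leb h𝒯
  obtain ⟨M, hM0, hM⟩ := exists_norm_kerFun_le h𝒯 hK
  let A : H →ₗ[ℝ] L2 𝒯 :=
    { toFun := toL2
      map_add' := fun β γ => by
        refine Lp.ext ?_
        filter_upwards [coeFn_toL2 h𝒯 hK β, coeFn_toL2 h𝒯 hK γ, coeFn_toL2 h𝒯 hK (β + γ),
          Lp.coeFn_add (toL2 β) (toL2 γ)] with t h1 h2 h3 h4
        rw [h3, h4, Pi.add_apply, h1, h2, RKHS.coe_add, Pi.add_apply]
      map_smul' := fun c β => by
        refine Lp.ext ?_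
        filter_upwards [coeFn_toL2 h𝒯 hK β, coeFn_toL2 h𝒯 hK (c • β),
          Lp.coeFn_smul c (toL2 β)] with t h1 h2 h3
        rw [h2, RingHom.id_apply, h3, Pi.smul_apply, h1, RKHS.coe_smul, Pi.smul_apply] }
  refine ⟨A.mkContinuous ((leb 𝒯).real Set.univ ^ (2 : ENNReal).toReal⁻¹ * M) fun β => ?_,
    fun β => rfl⟩
  have h1 := Lp.norm_le_of_ae_bound (f := toL2 β) (C := M * ‖β‖) (by positivity) (by
    filter_upwards [coeFn_toL2 h𝒯 hK β] with t ht
    rw [ht, ← inner_kerFun_one]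
    exact (norm_inner_le_norm _ _).trans (mul_le_mul_of_nonneg_right (hM t) (norm_nonneg _)))
  calc ‖A β‖ = ‖toL2 β‖ := rfl
    _ ≤ _ := h1
    _ = _ := by rw [mul_assoc]; rfl

/-- By the reproducing property, `(ι* f)(s) = ⟪K_s, ι* f⟫ = ⟪ι K_s, f⟫ = ∫ K(s,t) f(t) dt`. -/
theorem integralOp_scalarKernel_eq (h𝒯 : IsCompact 𝒯)
    (hK : Continuous fun p : 𝒯 × 𝒯 => scalarKernel H p.1 p.2)
    (ι : H →L[ℝ] L2 𝒯) (hι : ∀ β, ι β = toL2 β) :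
    integralOp (scalarKernel H) = ι ∘L ι.adjoint := by
  have hex := exists_isIntegralOp_of_continuous h𝒯 (scalarKernel H) hK
  rw [integralOp, dif_pos hex]
  ext1 f
  refine Lp.ext ?_
  rw [ContinuousLinearMap.comp_apply, hι]
  filter_upwards [hex.choose_spec f, coeFn_toL2 h𝒯 hK (ι.adjoint f)] with s h1 h2
  rw [h1, h2, ← inner_kerFun_one, ContinuousLinearMap.adjoint_inner_right, hι, L2.inner_def]
  refine integral_congr_ae ?_
  filter_upwards [coeFn_toL2 h𝒯 hK (RKHS.kerFun H s 1)] with t ht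
  have h3 : RKHS.kerFun H s 1 t = scalarKernel H s t := by
    rw [← inner_kerFun_one, real_inner_comm, inner_kerFun_kerFun]
  rw [ht, h3, RCLike.inner_apply, conj_trivial, mul_comm]

/-- The fallback value of `opSqrt` is `0`, so a nonzero value certifies that a genuine square root
was chosen. This spares the construction of square roots. -/
theorem opSqrt_spec {E : Type*} [NormedAddCommGroup E] [InnerProductSpace ℝ E] [CompleteSpace E]
    (A : E →L[ℝ] E) (h : opSqrt A ≠ 0) : (opSqrt A).IsPositive ∧ opSqrt A ∘L opSqrt A = A := by
  unfold opSqrt at h ⊢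
  split_ifs at h ⊢ with hex
  · exact hex.choose_spec
  · exact absurd rfl h

/-- If `L_{K^{1/2}}` is injective, every `β ∈ ℋ(K)` is `L_{K^{1/2}} f` for a unique `f = V β`, and
`V` is a coisometry. -/
theorem exists_coisometry (h𝒯 : IsCompact 𝒯)
    (hK : Continuous fun p : 𝒯 × 𝒯 => scalarKernel H p.1 p.2)
    (hpos : (sqrtK H : L2 𝒯 →L[ℝ] L2 𝒯).IsPositive)
    (hsq : (sqrtK H : L2 𝒯 →L[ℝ] L2 𝒯) ∘L sqrtK H = integralOp (scalarKernel H))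
    (hinj : Function.Injective (sqrtK H : L2 𝒯 →L[ℝ] L2 𝒯)) :
    ∃ V : H →L[ℝ] L2 𝒯, (∀ β, ‖V β‖ ≤ ‖β‖) ∧ (∀ β, toL2 β = sqrtK H (V β)) ∧
      ∀ f, ∃ β, V β = f ∧ ‖β‖ ≤ ‖f‖ := by
  obtain ⟨ι, hι⟩ := exists_embedding (H := H) h𝒯 hK
  have hL := integralOp_scalarKernel_eq h𝒯 hK ι hι
  -- Both squared norms equal `⟪L_K x, x⟫`. Douglas' lemma therefore applies in both directions: one
  -- gives `V`, the other lifts every `f` without increasing the norm.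
  have hnorm : ∀ x, ‖ι.adjoint x‖ = ‖sqrtK H x‖ := by
    intro x
    have h1 : ‖ι.adjoint x‖ ^ 2 = ‖sqrtK H x‖ ^ 2 := by
      rw [← real_inner_self_eq_norm_sq, ← real_inner_self_eq_norm_sq,
        ContinuousLinearMap.adjoint_inner_left, hpos.inner_left_eq_inner_right,
        ← ContinuousLinearMap.comp_apply ι, ← hL, ← hsq, ContinuousLinearMap.comp_apply]
    exact (pow_left_inj₀ (norm_nonneg _) (norm_nonneg _) two_ne_zero).1 h1
  have key : ∀ β : H, ∃ f : L2 𝒯, ‖f‖ ≤ ‖β‖ ∧ toL2 β = sqrtK H f := by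
    intro β
    obtain ⟨f, hf, h⟩ := exists_inner_eq_of_norm_le (ι.adjoint : L2 𝒯 →ₗ[ℝ] H)
      (sqrtK H : L2 𝒯 →ₗ[ℝ] L2 𝒯) (fun x => (hnorm x).le) β
    refine ⟨f, hf, ext_inner_left ℝ fun x => ?_⟩
    have := h x
    simp only [ContinuousLinearMap.coe_coe] at this
    rw [← hpos.inner_left_eq_inner_right, ← this, ContinuousLinearMap.adjoint_inner_left, hι]
  choose V hV hV' using key
  -- Injectivity of `L_{K^{1/2}}` makes the preimage unique, so the pointwise choice is linear.
  let V' : H →ₗ[ℝ] L2 𝒯 :=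
    { toFun := V
      map_add' := fun β γ => hinj (by rw [map_add, ← hV', ← hV', ← hV', ← hι, map_add, hι, hι])
      map_smul' := fun c β => hinj (by
        rw [RingHom.id_apply, map_smul, ← hV', ← hV', ← hι, map_smul, hι]) }
  refine ⟨V'.mkContinuous 1 fun β => by rw [one_mul]; exact hV β, hV, hV', fun f => ?_⟩
  obtain ⟨β, hβ, h⟩ := exists_inner_eq_of_norm_le (sqrtK H : L2 𝒯 →ₗ[ℝ] L2 𝒯)
    (ι.adjoint : L2 𝒯 →ₗ[ℝ] H) (fun x => (hnorm x).ge) f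
  refine ⟨β, hinj ?_, hβ⟩
  change sqrtK H (V β) = _
  rw [← hV']
  refine ext_inner_left ℝ fun x => ?_
  have := h x
  simp only [ContinuousLinearMap.coe_coe] at this
  rw [← hpos.inner_left_eq_inner_right, this, ContinuousLinearMap.adjoint_inner_left, hι]

end Embedding

/-! ### Second moment bounds for empirical averages within one task. -/

section Concentration

variable {Ω : Type*} [MeasurableSpace Ω] {P : Measure Ω}
  {E : Type*} [NormedAddCommGroup E] [InnerProductSpace ℝ E]

/-- Variances add under pairwise independence. Separating the number `m` of terms from the
normalization `N ≥ m` lets the bound serve one task inside a pooled sample. -/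
theorem lintegral_sq_centered_sum_le [IsProbabilityMeasure P] {f : ℕ → Ω → ℝ} {a M : ℝ} (hf : ∀ i, MemLp (f i) 2 P)
    (hindep : Pairwise fun i j => IndepFun (f i) (f j) P) (hmean : ∀ i, ∫ ω, f i ω ∂P = a)
    (hM : ∀ i, ∫ ω, f i ω ^ 2 ∂P ≤ M) {m N : ℕ} (hN : 0 < N) (hmN : m ≤ N) :
    ∫⁻ ω, ENNReal.ofReal (((1 / (N : ℝ)) * ∑ i ∈ Finset.range m, (f i ω - a)) ^ 2) ∂P ≤
      ENNReal.ofReal (M / N) := by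
  have hN' : (0 : ℝ) < N := by exact_mod_cast hN
  have hM0 : 0 ≤ M := (integral_nonneg fun ω => sq_nonneg (f 0 ω)).trans (hM 0)
  have hsum : MemLp (∑ i ∈ Finset.range m, f i) 2 P := memLp_finsetSum' _ fun i _ => hf i
  have hmeanS : ∫ ω, (∑ i ∈ Finset.range m, f i) ω ∂P = m * a := by
    simp only [Finset.sum_apply]
    rw [integral_finsetSum _ fun i _ => (hf i).integrable (by norm_num)]
    simp [hmean]
  have hvar : ∫ ω, ((∑ i ∈ Finset.range m, f i) ω - m * a) ^ 2 ∂P ≤ m * M := by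
    rw [← hmeanS, ← variance_eq_integral hsum.aemeasurable,
      IndepFun.variance_sum (fun i _ => hf i) (fun i _ j _ hij => hindep hij)]
    refine (Finset.sum_le_card_nsmul _ _ M fun i _ => ?_).trans_eq (by simp)
    exact (variance_le_expectation_sq (hf i).aestronglyMeasurable).trans (hM i)
  have e : ∀ ω, ((1 / (N : ℝ)) * ∑ i ∈ Finset.range m, (f i ω - a)) ^ 2 =
      (1 / (N : ℝ)) ^ 2 * ((∑ i ∈ Finset.range m, f i) ω - m * a) ^ 2 := by
    intro ω
    rw [mul_pow, Finset.sum_sub_distrib]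
    simp
  simp only [e]
  have hint : Integrable (fun ω => (1 / (N : ℝ)) ^ 2 *
      ((∑ i ∈ Finset.range m, f i) ω - m * a) ^ 2) P :=
    ((hsum.sub (memLp_const _)).integrable_sq).const_mul _
  rw [← ofReal_integral_eq_lintegral_ofReal hint
    (Eventually.of_forall fun ω => by positivity), integral_const_mul]
  refine ENNReal.ofReal_le_ofReal ?_
  have h1 : (m : ℝ) * M ≤ N * M := mul_le_mul_of_nonneg_right (by exact_mod_cast hmN) hM0
  calc (1 / (N : ℝ)) ^ 2 * ∫ ω, ((∑ i ∈ Finset.range m, f i) ω - m * a) ^ 2 ∂P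
      ≤ (1 / (N : ℝ)) ^ 2 * (N * M) := by gcongr; exact hvar.trans h1
    _ = M / N := by field_simp

/-- Square integrable curves and noise of one task, with second moment operator `T`, kurtosis
at most `κ` and noise variance at most `v`. -/
structure IsTaskSample [MeasurableSpace E] (P : Measure Ω) (Z : ℕ → Ω → E)
    (e : ℕ → Ω → ℝ) (T : E →L[ℝ] E) (κ v : ℝ) : Prop where
  aemeasurable_Z : ∀ i, AEMeasurable (Z i) P
  aemeasurable_e : ∀ i, AEMeasurable (e i) P
  indep : Pairwise fun i j => IndepFun (fun ω => (Z i ω, e i ω)) (fun ω => (Z j ω, e j ω)) P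
  indep_noise : ∀ i, IndepFun (Z i) (e i) P
  identDistrib_Z : ∀ i, IdentDistrib (Z i) (Z 0) P P
  identDistrib_e : ∀ i, IdentDistrib (e i) (e 0) P P
  inner_T : ∀ f g, ⟪T f, g⟫ = ∫ ω, ⟪Z 0 ω, f⟫ * ⟪Z 0 ω, g⟫ ∂P
  integrable_pow_four : ∀ f, Integrable (fun ω => ⟪Z 0 ω, f⟫ ^ 4) P
  kurtosis_nonneg : 0 ≤ κ
  kurtosis : ∀ f, ∫ ω, ⟪Z 0 ω, f⟫ ^ 4 ∂P ≤ κ * ⟪T f, f⟫ ^ 2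
  memLp_e : MemLp (e 0) 2 P
  mean_e : ∫ ω, e 0 ω ∂P = 0
  variance_e : ∫ ω, e 0 ω ^ 2 ∂P ≤ v

namespace IsTaskSample

variable [MeasurableSpace E] {Z : ℕ → Ω → E} {e : ℕ → Ω → ℝ} {T : E →L[ℝ] E}
  {κ v : ℝ}

theorem inner_T_self (h : IsTaskSample P Z e T κ v) (f : E) :
    ⟪T f, f⟫ = ∫ ω, ⟪Z 0 ω, f⟫ ^ 2 ∂P := by
  rw [h.inner_T]
  simp only [sq]

theorem inner_T_self_nonneg (h : IsTaskSample P Z e T κ v) (f : E) : 0 ≤ ⟪T f, f⟫ := by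
  rw [h.inner_T_self]
  exact integral_nonneg fun ω => sq_nonneg _

theorem symm (h : IsTaskSample P Z e T κ v) (f g : E) : ⟪T f, g⟫ = ⟪f, T g⟫ := by
  rw [real_inner_comm _ f, h.inner_T, h.inner_T]
  simp only [mul_comm]

variable [BorelSpace E]

theorem aemeasurable_inner (h : IsTaskSample P Z e T κ v) (i : ℕ) (f : E) :
    AEMeasurable (fun ω => ⟪Z i ω, f⟫) P :=
  (by fun_prop : Continuous fun x : E => ⟪x, f⟫).measurable.comp_aemeasurable (h.aemeasurable_Z i)

theorem identDistrib_inner (h : IsTaskSample P Z e T κ v) (i : ℕ) (f : E) :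
    IdentDistrib (fun ω => ⟪Z i ω, f⟫) (fun ω => ⟪Z 0 ω, f⟫) P P :=
  (h.identDistrib_Z i).comp (by fun_prop : Continuous fun x : E => ⟪x, f⟫).measurable

theorem memLp_inner_sq (h : IsTaskSample P Z e T κ v) (f : E) :
    MemLp (fun ω => ⟪Z 0 ω, f⟫ ^ 2) 2 P := by
  rw [memLp_two_iff_integrable_sq ((h.aemeasurable_inner 0 f).pow_const 2).aestronglyMeasurable]
  simpa only [← pow_mul] using h.integrable_pow_four f

theorem memLp_inner [IsProbabilityMeasure P] (h : IsTaskSample P Z e T κ v) (i : ℕ) (f : E) :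
    MemLp (fun ω => ⟪Z i ω, f⟫) 2 P := by
  rw [(h.identDistrib_inner i f).memLp_iff,
    memLp_two_iff_integrable_sq (h.aemeasurable_inner 0 f).aestronglyMeasurable]
  exact (h.memLp_inner_sq f).integrable (by norm_num)

/-- Cauchy–Schwarz splits the mixed fourth moment, and the kurtosis bound handles each factor. -/
theorem integral_mul_sq_le (h : IsTaskSample P Z e T κ v) (f g : E) :
    ∫ ω, (⟪Z 0 ω, f⟫ * ⟪Z 0 ω, g⟫) ^ 2 ∂P ≤ κ * (⟪T f, f⟫ * ⟪T g, g⟫) := by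
  have h2 : ENNReal.ofReal 2 = 2 := by norm_num
  have h1 := integral_mul_le_Lp_mul_Lq_of_nonneg (μ := P) Real.HolderConjugate.two_two
    (f := fun ω => ⟪Z 0 ω, f⟫ ^ 2) (g := fun ω => ⟪Z 0 ω, g⟫ ^ 2)
    (Eventually.of_forall fun ω => sq_nonneg _) (Eventually.of_forall fun ω => sq_nonneg _)
    (by rw [h2]; exact h.memLp_inner_sq f) (by rw [h2]; exact h.memLp_inner_sq g)
  simp only [mul_pow]
  refine h1.trans ?_
  have key : ∀ f, (∫ ω, (⟪Z 0 ω, f⟫ ^ 2) ^ (2 : ℝ) ∂P) ^ (1 / (2 : ℝ)) ≤ √κ * ⟪T f, f⟫ := by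
    intro f
    rw [← Real.sqrt_eq_rpow]
    have : ∫ ω, (⟪Z 0 ω, f⟫ ^ 2) ^ (2 : ℝ) ∂P = ∫ ω, ⟪Z 0 ω, f⟫ ^ 4 ∂P := by
      refine integral_congr_ae (Eventually.of_forall fun ω => ?_)
      simp only [Real.rpow_two, ← pow_mul]
    rw [this]
    refine (Real.sqrt_le_sqrt (h.kurtosis f)).trans_eq ?_
    rw [Real.sqrt_mul h.kurtosis_nonneg, Real.sqrt_sq (h.inner_T_self_nonneg f)]
  calc _ ≤ (√κ * ⟪T f, f⟫) * (√κ * ⟪T g, g⟫) := mul_le_mul (key f) (key g)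
        (Real.rpow_nonneg (integral_nonneg fun ω => Real.rpow_nonneg (sq_nonneg _) _) _)
        (mul_nonneg (Real.sqrt_nonneg _) (h.inner_T_self_nonneg f))
    _ = (√κ * √κ) * (⟪T f, f⟫ * ⟪T g, g⟫) := by ring
    _ = _ := by rw [Real.mul_self_sqrt h.kurtosis_nonneg]

theorem lintegral_moment_deviation_le [IsProbabilityMeasure P] (h : IsTaskSample P Z e T κ v) (f g : E) {m N : ℕ}
    (hN : 0 < N) (hmN : m ≤ N) :
    ∫⁻ ω, ENNReal.ofReal (((1 / (N : ℝ)) * ∑ i ∈ Finset.range m,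
      (⟪Z i ω, f⟫ * ⟪Z i ω, g⟫ - ⟪T f, g⟫)) ^ 2) ∂P ≤
      ENNReal.ofReal (κ * (⟪T f, f⟫ * ⟪T g, g⟫) / N) := by
  have hmeas : Measurable fun x : E => ⟪x, f⟫ * ⟪x, g⟫ :=
    (by fun_prop : Continuous fun x : E => ⟪x, f⟫ * ⟪x, g⟫).measurable
  have hid : ∀ i, IdentDistrib (fun ω => ⟪Z i ω, f⟫ * ⟪Z i ω, g⟫)
      (fun ω => ⟪Z 0 ω, f⟫ * ⟪Z 0 ω, g⟫) P P := fun i => (h.identDistrib_Z i).comp hmeas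
  refine lintegral_sq_centered_sum_le (f := fun i ω => ⟪Z i ω, f⟫ * ⟪Z i ω, g⟫) (fun i => ?_)
    (fun i j hij => ?_) (fun i => ?_) (fun i => ?_) hN hmN
  · rw [(hid i).memLp_iff, memLp_two_iff_integrable_sq
      (by exact ((h.aemeasurable_inner 0 f).mul (h.aemeasurable_inner 0 g)).aestronglyMeasurable)]
    simp only [mul_pow]
    exact (h.memLp_inner_sq f).integrable_mul (h.memLp_inner_sq g)
  · exact (h.indep hij).comp (hmeas.comp measurable_fst) (hmeas.comp measurable_fst)
  · rw [(hid i).integral_eq, h.inner_T]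
  · have := ((hid i).comp (measurable_id.pow_const 2)).integral_eq
    simp only [Function.comp_def, id] at this
    rw [this]
    exact h.integral_mul_sq_le f g

theorem lintegral_noise_le [IsProbabilityMeasure P] (h : IsTaskSample P Z e T κ v) (g : E) {m N : ℕ}
    (hN : 0 < N) (hmN : m ≤ N) :
    ∫⁻ ω, ENNReal.ofReal (((1 / (N : ℝ)) * ∑ i ∈ Finset.range m,
      e i ω * ⟪Z i ω, g⟫) ^ 2) ∂P ≤ ENNReal.ofReal (v * ⟪T g, g⟫ / N) := by
  have hmeas : Measurable fun x : E => ⟪x, g⟫ := (by fun_prop : Continuous _).measurable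
  have hind : ∀ i, IndepFun (e i) (fun ω => ⟪Z i ω, g⟫) P := fun i =>
    (h.indep_noise i).symm.comp measurable_id hmeas
  have he : ∀ i, MemLp (e i) 2 P := fun i => (h.identDistrib_e i).memLp_iff.2 h.memLp_e
  have hind2 : ∀ i, IndepFun (fun ω => e i ω ^ 2) (fun ω => ⟪Z i ω, g⟫ ^ 2) P := fun i =>
    (hind i).comp (measurable_id.pow_const 2) (measurable_id.pow_const 2)
  have := lintegral_sq_centered_sum_le (P := P) (f := fun i ω => e i ω * ⟪Z i ω, g⟫) (a := 0)
    (M := v * ⟪T g, g⟫) (fun i => ?_) (fun i j hij => ?_) (fun i => ?_) (fun i => ?_) hN hmN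
  · simpa using this
  · rw [memLp_two_iff_integrable_sq
      (by exact ((h.aemeasurable_e i).mul (h.aemeasurable_inner i g)).aestronglyMeasurable)]
    simp only [mul_pow]
    exact (hind2 i).integrable_mul (he i).integrable_sq (h.memLp_inner i g).integrable_sq
  · have hm : Measurable fun p : E × ℝ => p.2 * ⟪p.1, g⟫ :=
      measurable_snd.mul (hmeas.comp measurable_fst)
    exact (h.indep hij).comp hm hm
  · rw [(hind i).integral_fun_mul_eq_mul_integral (he i).aestronglyMeasurable
      (h.memLp_inner i g).aestronglyMeasurable, (h.identDistrib_e i).integral_eq, h.mean_e, zero_mul]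
  · simp only [mul_pow]
    rw [(hind2 i).integral_fun_mul_eq_mul_integral (he i).integrable_sq.aestronglyMeasurable
      (h.memLp_inner i g).integrable_sq.aestronglyMeasurable, h.inner_T_self]
    have h1 := ((h.identDistrib_e i).comp (measurable_id.pow_const 2)).integral_eq
    have h2 := ((h.identDistrib_inner i g).comp (measurable_id.pow_const 2)).integral_eq
    simp only [Function.comp_def, id] at h1 h2
    rw [h1, h2]
    exact mul_le_mul_of_nonneg_right h.variance_e (integral_nonneg fun ω => sq_nonneg _)

end IsTaskSample

end Concentration

/-! ### Uniform control of empirical moments and noise via weighted Hilbert–Schmidt norms. -/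

section GoodEvent

variable {Ω : Type*} {E : Type*} [NormedAddCommGroup E] [InnerProductSpace ℝ E]

/-- Deviation of the empirical second moment form from that of the operator `T`, with sample size
`m` and normalization `1 / N`. -/
noncomputable def momentDev (Z : ℕ → Ω → E) (T : E →L[ℝ] E) (m N : ℕ) (ω : Ω) (f g : E) : ℝ :=
  (1 / (N : ℝ)) * ∑ i ∈ Finset.range m, (⟪Z i ω, f⟫ * ⟪Z i ω, g⟫ - ⟪T f, g⟫)

/-- The noise functional `g ↦ N⁻¹ ∑ e i ⟪Z i, g⟫`. -/
noncomputable def noiseDev (Z : ℕ → Ω → E) (e : ℕ → Ω → ℝ) (m N : ℕ) (ω : Ω) (g : E) : ℝ :=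
  (1 / (N : ℝ)) * ∑ i ∈ Finset.range m, e i ω * ⟪Z i ω, g⟫

/-- The quadratic form `⟪(T + lam) g, g⟫`. -/
noncomputable def regForm (T : E →L[ℝ] E) (lam : ℝ) (g : E) : ℝ := ⟪T g, g⟫ + lam * ‖g‖ ^ 2

theorem exists_inner_eq_momentDev (Z : ℕ → Ω → E) (T : E →L[ℝ] E) (m N : ℕ) (ω : Ω) :
    ∃ G : E →L[ℝ] E, ∀ f g, ⟪G f, g⟫ = momentDev Z T m N ω f g := by
  refine ⟨(1 / (N : ℝ)) • ∑ i ∈ Finset.range m,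
    ((innerSL ℝ (Z i ω)).smulRight (Z i ω) - T), fun f g => ?_⟩
  simp [momentDev, real_inner_smul_left, sum_apply, sum_inner, inner_sub_left,
    ← Nat.cast_smul_eq_nsmul ℝ]

theorem momentDev_comm (Z : ℕ → Ω → E) (T : E →L[ℝ] E) (hT : ∀ f g, ⟪T f, g⟫ = ⟪f, T g⟫)
    (m N : ℕ) (ω : Ω) (f g : E) : momentDev Z T m N ω f g = momentDev Z T m N ω g f := by
  simp only [momentDev, hT f g, real_inner_comm _ f, mul_comm]

theorem sum_le_of_tsum_ofReal_le {ι : Type*} {x : ι → ℝ} {a : ℝ} (hx : ∀ j, 0 ≤ x j) (ha : 0 ≤ a)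
    (h : ∑' j, ENNReal.ofReal (x j) ≤ ENNReal.ofReal a) (J : Finset ι) : ∑ j ∈ J, x j ≤ a := by
  rw [← ENNReal.ofReal_le_ofReal_iff ha, ENNReal.ofReal_sum_of_nonneg fun j _ => hx j]
  exact (ENNReal.sum_le_tsum J).trans h

/-- A symmetric form is bounded by its weighted Hilbert–Schmidt norm. -/
theorem inner_apply_sq_le_of_tsum_le {ι : Type*} (φ : HilbertBasis ι ℝ E) (G : E →L[ℝ] E)
    (hG : ∀ f g, ⟪G f, g⟫ = ⟪f, G g⟫) {u w : ι → ℝ} (hu : ∀ j, 0 < u j) (hw : ∀ j, 0 < w j)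
    {η : ℝ} (hη : 0 ≤ η)
    (h : ∑' k, ∑' j, ENNReal.ofReal (⟪G (φ j), φ k⟫ ^ 2 / (u j * w k)) ≤ ENNReal.ofReal η)
    {f g : E} {a b : ℝ} (hf : ∀ J : Finset ι, ∑ j ∈ J, u j * ⟪f, φ j⟫ ^ 2 ≤ a)
    (hg : ∀ J : Finset ι, ∑ j ∈ J, w j * ⟪g, φ j⟫ ^ 2 ≤ b) :
    ⟪G f, g⟫ ^ 2 ≤ η * (a * b) := by
  have ha : 0 ≤ a := by simpa using hf ∅
  -- Row sums of the weighted Hilbert–Schmidt norm. Weighted Cauchy–Schwarz is applied twice: within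
  -- each row to bound `⟪G f, φ k⟫`, then across rows.
  let c : ι → ENNReal := fun k => ∑' j, ENNReal.ofReal (⟪G (φ j), φ k⟫ ^ 2 / (u j * w k))
  have hc : ∀ k, c k ≠ ⊤ := fun k =>
    ne_top_of_le_ne_top ENNReal.ofReal_ne_top ((ENNReal.le_tsum k).trans h)
  have hpos : ∀ j k, 0 ≤ ⟪G (φ j), φ k⟫ ^ 2 / (u j * w k) := fun j k =>
    div_nonneg (sq_nonneg _) (mul_pos (hu j) (hw k)).le
  have hcs : ∀ K : Finset ι, ∑ k ∈ K, (c k).toReal ≤ η := by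
    refine sum_le_of_tsum_ofReal_le (fun k => ENNReal.toReal_nonneg) hη ?_
    simp only [ENNReal.ofReal_toReal (hc _)]
    exact h
  have hk : ∀ k, ⟪G f, φ k⟫ ^ 2 ≤ (c k).toReal * (w k * a) := by
    intro k
    rw [hG, real_inner_comm]
    refine abs_inner_le_of_weighted φ (fun j => u j * w k) (fun j => mul_pos (hu j) (hw k)) _ _
      (fun J => ?_) (fun J => ?_)
    · have := sum_le_of_tsum_ofReal_le (fun j => hpos j k) ENNReal.toReal_nonneg
        (ENNReal.ofReal_toReal (hc k)).ge J
      refine le_trans (le_of_eq (Finset.sum_congr rfl fun j _ => ?_)) this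
      rw [hG (φ j), real_inner_comm]
    · refine le_trans (le_of_eq ?_) (mul_le_mul_of_nonneg_left (hf J) (hw k).le)
      rw [Finset.mul_sum]
      exact Finset.sum_congr rfl fun j _ => by ring
  have := abs_inner_le_of_weighted φ w hw (G f) g (a := η * a) (fun K => ?_) hg
  · rwa [mul_assoc] at this
  · calc ∑ k ∈ K, ⟪G f, φ k⟫ ^ 2 / w k ≤ ∑ k ∈ K, (c k).toReal * a := by
          refine Finset.sum_le_sum fun k _ => ?_
          rw [div_le_iff₀ (hw k)]
          exact (hk k).trans_eq (by ring)
      _ = (∑ k ∈ K, (c k).toReal) * a := (Finset.sum_mul _ _ _).symm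
      _ ≤ η * a := mul_le_mul_of_nonneg_right (hcs K) ha

variable [MeasurableSpace Ω] {P : Measure Ω} [MeasurableSpace E] [BorelSpace E] {Z : ℕ → Ω → E} {e : ℕ → Ω → ℝ} {T : E →L[ℝ] E} {κ v : ℝ}

theorem measure_le_of_lintegral_le {S : Ω → ENNReal} (hS : AEMeasurable S P) {x η : ℝ}
    (hη : 0 < η) (h : ∫⁻ ω, S ω ∂P ≤ ENNReal.ofReal x) :
    P {ω | ENNReal.ofReal η ≤ S ω} ≤ ENNReal.ofReal (x / η) := by
  refine (meas_ge_le_lintegral_div hS (ENNReal.ofReal_pos.2 hη).ne' ENNReal.ofReal_ne_top).trans ?_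
  rw [ENNReal.ofReal_div_of_pos hη]
  exact ENNReal.div_le_div_right h _

/-- The kurtosis bound on the `(j,k)` entry is a product, so the expected double sum factorizes into
two weighted traces of `T`. Markov's inequality concludes. -/
theorem IsTaskSample.measure_momentDev_le [IsProbabilityMeasure P] (h : IsTaskSample P Z e T κ v) (φ : HilbertBasis ℕ ℝ E)
    {u w : ℕ → ℝ} (hu : ∀ j, 0 < u j) (hw : ∀ j, 0 < w j) {a b : ℝ} (ha : 0 ≤ a)
    (hua : ∑' j, ENNReal.ofReal (⟪T (φ j), φ j⟫ / u j) ≤ ENNReal.ofReal a)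
    (hwb : ∑' j, ENNReal.ofReal (⟪T (φ j), φ j⟫ / w j) ≤ ENNReal.ofReal b)
    {m N : ℕ} (hN : 0 < N) (hmN : m ≤ N) {η : ℝ} (hη : 0 < η) :
    P {ω | ENNReal.ofReal η ≤ ∑' k, ∑' j,
      ENNReal.ofReal (momentDev Z T m N ω (φ j) (φ k) ^ 2 / (u j * w k))} ≤
      ENNReal.ofReal (κ * (a * b) / N / η) := by
  have hmeas : ∀ j k, AEMeasurable (fun ω =>
      ENNReal.ofReal (momentDev Z T m N ω (φ j) (φ k) ^ 2 / (u j * w k))) P := by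
    intro j k
    refine AEMeasurable.ennreal_ofReal (AEMeasurable.div_const (AEMeasurable.pow_const ?_ 2) _)
    refine AEMeasurable.const_mul (Finset.aemeasurable_fun_sum _ fun i _ => ?_) _
    exact ((h.aemeasurable_inner i _).mul (h.aemeasurable_inner i _)).sub_const _
  refine measure_le_of_lintegral_le (AEMeasurable.tsum fun k => AEMeasurable.tsum fun j =>
    hmeas j k) hη ?_
  rw [lintegral_tsum fun k => AEMeasurable.tsum fun j => hmeas j k]
  have hκ : 0 ≤ κ / N := div_nonneg h.kurtosis_nonneg (Nat.cast_nonneg _)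
  have ht := fun j => h.inner_T_self_nonneg (φ j)
  have hjk : ∀ j k, ∫⁻ ω, ENNReal.ofReal (momentDev Z T m N ω (φ j) (φ k) ^ 2 / (u j * w k)) ∂P ≤
      ENNReal.ofReal (κ / N) * ENNReal.ofReal (⟪T (φ k), φ k⟫ / w k) *
        ENNReal.ofReal (⟪T (φ j), φ j⟫ / u j) := by
    intro j k
    have hpos := mul_pos (hu j) (hw k)
    have e1 : ∀ ω, ENNReal.ofReal (momentDev Z T m N ω (φ j) (φ k) ^ 2 / (u j * w k)) =
        ENNReal.ofReal (u j * w k)⁻¹ * ENNReal.ofReal (momentDev Z T m N ω (φ j) (φ k) ^ 2) := by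
      intro ω
      rw [← ENNReal.ofReal_mul (inv_nonneg.2 hpos.le), div_eq_inv_mul]
    simp only [e1]
    rw [lintegral_const_mul' _ _ ENNReal.ofReal_ne_top, ← ENNReal.ofReal_mul hκ,
      ← ENNReal.ofReal_mul (mul_nonneg hκ (div_nonneg (ht k) (hw k).le))]
    refine (mul_le_mul_right (h.lintegral_moment_deviation_le (φ j) (φ k) hN hmN) _).trans_eq ?_
    rw [← ENNReal.ofReal_mul (inv_nonneg.2 hpos.le)]
    congr 1
    have := (hu j).ne'
    have := (hw k).ne'
    field_simp
  calc ∑' k, ∫⁻ ω, ∑' j, ENNReal.ofReal (momentDev Z T m N ω (φ j) (φ k) ^ 2 / (u j * w k)) ∂P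
      ≤ ∑' k, ∑' j, ENNReal.ofReal (κ / N) * ENNReal.ofReal (⟪T (φ k), φ k⟫ / w k) *
        ENNReal.ofReal (⟪T (φ j), φ j⟫ / u j) := by
        refine ENNReal.tsum_le_tsum fun k => ?_
        rw [lintegral_tsum fun j => hmeas j k]
        exact ENNReal.tsum_le_tsum fun j => hjk j k
    _ = ENNReal.ofReal (κ / N) * (∑' k, ENNReal.ofReal (⟪T (φ k), φ k⟫ / w k)) *
        ∑' j, ENNReal.ofReal (⟪T (φ j), φ j⟫ / u j) := by
        simp only [ENNReal.tsum_mul_left, ENNReal.tsum_mul_right]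
    _ ≤ ENNReal.ofReal (κ / N) * ENNReal.ofReal b * ENNReal.ofReal a := by gcongr
    _ = ENNReal.ofReal (κ * (a * b) / N) := by
        rw [mul_assoc, mul_comm (ENNReal.ofReal b), ← ENNReal.ofReal_mul ha,
          ← ENNReal.ofReal_mul hκ]
        congr 1
        ring

theorem IsTaskSample.measure_noiseDev_le [IsProbabilityMeasure P] (h : IsTaskSample P Z e T κ v) (φ : HilbertBasis ℕ ℝ E)
    {w : ℕ → ℝ} (hw : ∀ j, 0 < w j) {b : ℝ}
    (hwb : ∑' j, ENNReal.ofReal (⟪T (φ j), φ j⟫ / w j) ≤ ENNReal.ofReal b)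
    {m N : ℕ} (hN : 0 < N) (hmN : m ≤ N) {η : ℝ} (hη : 0 < η) :
    P {ω | ENNReal.ofReal η ≤ ∑' k, ENNReal.ofReal (noiseDev Z e m N ω (φ k) ^ 2 / w k)} ≤
      ENNReal.ofReal (v * b / N / η) := by
  have hmeas : ∀ k, AEMeasurable (fun ω =>
      ENNReal.ofReal (noiseDev Z e m N ω (φ k) ^ 2 / w k)) P := by
    intro k
    refine AEMeasurable.ennreal_ofReal (AEMeasurable.div_const (AEMeasurable.pow_const ?_ 2) _)
    refine AEMeasurable.const_mul (Finset.aemeasurable_fun_sum _ fun i _ => ?_) _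
    exact (h.aemeasurable_e i).mul (h.aemeasurable_inner i _)
  refine measure_le_of_lintegral_le (AEMeasurable.tsum hmeas) hη ?_
  rw [lintegral_tsum hmeas]
  have hv : 0 ≤ v / N := div_nonneg
    ((integral_nonneg fun ω => sq_nonneg (e 0 ω)).trans h.variance_e) (Nat.cast_nonneg _)
  have hk : ∀ k, ∫⁻ ω, ENNReal.ofReal (noiseDev Z e m N ω (φ k) ^ 2 / w k) ∂P ≤
      ENNReal.ofReal (v / N) * ENNReal.ofReal (⟪T (φ k), φ k⟫ / w k) := by
    intro k
    have e1 : ∀ ω, ENNReal.ofReal (noiseDev Z e m N ω (φ k) ^ 2 / w k) =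
        ENNReal.ofReal (w k)⁻¹ * ENNReal.ofReal (noiseDev Z e m N ω (φ k) ^ 2) := by
      intro ω
      rw [← ENNReal.ofReal_mul (inv_nonneg.2 (hw k).le), div_eq_inv_mul]
    simp only [e1]
    rw [lintegral_const_mul' _ _ ENNReal.ofReal_ne_top, ← ENNReal.ofReal_mul hv]
    refine (mul_le_mul_right (h.lintegral_noise_le (φ k) hN hmN) _).trans_eq ?_
    rw [← ENNReal.ofReal_mul (inv_nonneg.2 (hw k).le)]
    congr 1
    have := (hw k).ne'
    field_simp
  calc _ ≤ ∑' k, ENNReal.ofReal (v / N) * ENNReal.ofReal (⟪T (φ k), φ k⟫ / w k) :=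
        ENNReal.tsum_le_tsum hk
    _ ≤ ENNReal.ofReal (v / N) * ENNReal.ofReal b := by rw [ENNReal.tsum_mul_left]; gcongr
    _ = ENNReal.ofReal (v * b / N) := by
        rw [← ENNReal.ofReal_mul hv]
        congr 1
        ring

/-- The event on which empirical second moments and noise of a task are controlled relative to the
regularized form of `T₀`. -/
def IsGood (T₀ : E →L[ℝ] E) (lam : ℝ) (Z : ℕ → Ω → E) (e : ℕ → Ω → ℝ) (T : E →L[ℝ] E) (m N : ℕ)
    (η₁ η₂ η₃ : ℝ) (ω : Ω) : Prop :=
  ∀ f g, momentDev Z T m N ω f g ^ 2 ≤ η₁ * (regForm T₀ lam f * regForm T₀ lam g) ∧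
    momentDev Z T m N ω f g ^ 2 ≤ η₂ * (‖f‖ ^ 2 * regForm T₀ lam g) ∧
    noiseDev Z e m N ω g ^ 2 ≤ η₃ * regForm T₀ lam g

/-- The weights `s j + lam` turn weighted traces into the effective dimension `D`. The middle bound
uses weight `1` on one side, because the model mismatch is bounded only in norm; it then costs `τ D`
instead of `D²`, with `τ` bounding the trace of `T₀`. -/
theorem IsTaskSample.measure_not_isGood_le [IsProbabilityMeasure P]
    (h : IsTaskSample P Z e T κ v)
    (φ : HilbertBasis ℕ ℝ E)
    {T₀ : E →L[ℝ] E} (hT₀ : ∀ f g, ⟪T₀ f, g⟫ = ⟪f, T₀ g⟫) {s : ℕ → ℝ} (hs : ∀ j, 0 < s j)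
    (hφ : ∀ j, T₀ (φ j) = s j • φ j) {c : ℝ} (hc : 0 ≤ c)
    (htc : ∀ j, ⟪T (φ j), φ j⟫ ≤ c * s j) {lam D τ : ℝ} (hlam : 0 < lam) (hD : 0 ≤ D) (hτ : 0 ≤ τ)
    (hsD : ∑' j, ENNReal.ofReal (s j / (s j + lam)) ≤ ENNReal.ofReal D)
    (hsτ : ∑' j, ENNReal.ofReal (s j) ≤ ENNReal.ofReal τ)
    {m N : ℕ} (hN : 0 < N) (hmN : m ≤ N) {η₁ η₂ η₃ : ℝ} (h1 : 0 < η₁) (h2 : 0 < η₂) (h3 : 0 < η₃) :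
    P {ω | ¬ IsGood T₀ lam Z e T m N η₁ η₂ η₃ ω} ≤
      ENNReal.ofReal (κ * ((c * D) * (c * D)) / N / η₁) +
      ENNReal.ofReal (κ * ((c * τ) * (c * D)) / N / η₂) + ENNReal.ofReal (v * (c * D) / N / η₃) := by
  have hw : ∀ j, 0 < s j + lam := fun j => add_pos (hs j) hlam
  have hwD : ∑' j, ENNReal.ofReal (⟪T (φ j), φ j⟫ / (s j + lam)) ≤ ENNReal.ofReal (c * D) := by
    rw [ENNReal.ofReal_mul hc]
    refine le_trans ?_ (mul_le_mul_right hsD _)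
    rw [← ENNReal.tsum_mul_left]
    refine ENNReal.tsum_le_tsum fun j => ?_
    rw [← ENNReal.ofReal_mul hc]
    refine ENNReal.ofReal_le_ofReal ?_
    rw [← mul_div_assoc]
    exact div_le_div_of_nonneg_right (htc j) (hw j).le
  have hwτ : ∑' j, ENNReal.ofReal (⟪T (φ j), φ j⟫ / 1) ≤ ENNReal.ofReal (c * τ) := by
    rw [ENNReal.ofReal_mul hc]
    refine le_trans ?_ (mul_le_mul_right hsτ _)
    rw [← ENNReal.tsum_mul_left]
    refine ENNReal.tsum_le_tsum fun j => ?_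
    rw [← ENNReal.ofReal_mul hc, div_one]
    exact ENNReal.ofReal_le_ofReal (htc j)
  have m1 := h.measure_momentDev_le φ hw hw (mul_nonneg hc hD) hwD hwD hN hmN h1
  have m2 := h.measure_momentDev_le φ (u := fun _ => 1) (fun _ => one_pos) hw (mul_nonneg hc hτ)
    hwτ hwD hN hmN h2
  have m3 := h.measure_noiseDev_le φ hw hwD hN hmN h3
  refine le_trans (measure_mono ?_) ((measure_union_le _ _).trans
    (add_le_add ((measure_union_le _ _).trans (add_le_add m1 m2)) m3))
  intro ω hω
  by_contra hcon
  simp only [Set.mem_union, Set.mem_ofPred_eq, not_or, not_le] at hcon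
  obtain ⟨⟨c1, c2⟩, c3⟩ := hcon
  refine hω fun f g => ?_
  obtain ⟨G, hG⟩ := exists_inner_eq_momentDev Z T m N ω
  have hGs : ∀ f g, ⟪G f, g⟫ = ⟪f, G g⟫ := fun f g => by
    rw [hG, real_inner_comm, hG, momentDev_comm Z T h.symm]
  simp only [← hG] at c1 c2 ⊢
  have hq : ∀ g : E, ∀ J : Finset ℕ, ∑ j ∈ J, (s j + lam) * ⟪g, φ j⟫ ^ 2 ≤ regForm T₀ lam g :=
    fun g J => sum_weighted_sq_le φ s (fun j => (hs j).le) T₀ hT₀ hφ hlam.le g J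
  have hn : ∀ J : Finset ℕ, ∑ j ∈ J, 1 * ⟪f, φ j⟫ ^ 2 ≤ ‖f‖ ^ 2 := by
    intro J
    simpa [real_inner_comm] using φ.orthonormal.sum_inner_products_le f (s := J)
  refine ⟨inner_apply_sq_le_of_tsum_le φ G hGs hw hw h1.le c1.le (hq f) (hq g),
    inner_apply_sq_le_of_tsum_le φ G hGs (fun _ => one_pos) hw h2.le c2.le hn (hq g), ?_⟩
  have en : ∀ g, noiseDev Z e m N ω g =
      ⟪(1 / (N : ℝ)) • ∑ i ∈ Finset.range m, e i ω • Z i ω, g⟫ := by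
    intro g
    simp [noiseDev, real_inner_smul_left, sum_inner]
  rw [en]
  refine abs_inner_le_of_weighted φ _ hw _ g (fun J => ?_) (hq g)
  simp only [← en]
  exact sum_le_of_tsum_ofReal_le (fun k => div_nonneg (sq_nonneg _) (hw k).le) h3.le c3.le J

end GoodEvent

/-! ### Effective dimension under polynomial eigenvalue decay -/

section EffectiveDimension

theorem sum_Ico_rpow_neg_le {p : ℝ} (hp : 1 < p) {J n : ℕ} (hJ : 0 < J) (hJn : J ≤ n) :
    ∑ j ∈ Finset.Ico J n, ((j : ℝ) + 1) ^ (-p) ≤ (J : ℝ) ^ (1 - p) / (p - 1) := by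
  have hJ' : (0 : ℝ) < J := by exact_mod_cast hJ
  have hanti : AntitoneOn (fun x : ℝ => x ^ (-p)) (Set.Icc (J : ℝ) n) := fun x hx y _ hxy =>
    Real.rpow_le_rpow_of_nonpos (hJ'.trans_le hx.1) hxy (by linarith)
  have h1 := hanti.sum_le_integral_Ico hJn
  have h0 : (0 : ℝ) ∉ Set.uIcc (J : ℝ) n := by
    rw [Set.uIcc_of_le (by exact_mod_cast hJn)]
    exact fun h => absurd h.1 (not_le.2 hJ')
  rw [integral_rpow (Or.inr ⟨by linarith, h0⟩)] at h1
  have hn : (0 : ℝ) ≤ (n : ℝ) ^ (1 - p) := Real.rpow_nonneg (Nat.cast_nonneg _) _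
  have e : -p + 1 = 1 - p := by ring
  rw [e] at h1
  push_cast at h1
  refine h1.trans ?_
  rw [← neg_div_neg_eq, neg_sub, neg_sub]
  exact div_le_div_of_nonneg_right (by linarith) (by linarith)

/-- Split the sum at `J = ⌈lam^(-1/p)⌉`: the first `J` terms are at most `1`, and the tail is at
most `C/lam` times a power sum of order `J^(1-p)`. Both pieces are of order `lam^(-1/p)`. -/
theorem exists_effective_dimension_le {p C Λ : ℝ} (hp : 1 < p) (hC : 0 ≤ C) (hΛ : 0 < Λ)
    {s : ℕ → ℝ} (hs : ∀ j, 0 < s j) (hsC : ∀ j : ℕ, s j ≤ C * ((j : ℝ) + 1) ^ (-p)) :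
    ∃ C', 0 ≤ C' ∧ ∀ lam, 0 < lam → lam ≤ Λ →
      ∑' j, ENNReal.ofReal (s j / (s j + lam)) ≤ ENNReal.ofReal (C' * lam ^ (-(1 / p))) := by
  have hp0 : 0 < p := by linarith
  refine ⟨1 + Λ ^ (1 / p) + C / (p - 1), by
    have := div_nonneg hC (sub_pos.2 hp).le
    positivity, fun lam hlam hlamΛ => ?_⟩
  have hterm : ∀ j, 0 ≤ s j / (s j + lam) := fun j =>
    div_nonneg (hs j).le (add_pos (hs j) hlam).le
  have hterm1 : ∀ j, s j / (s j + lam) ≤ 1 := fun j => by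
    rw [div_le_one (add_pos (hs j) hlam)]
    linarith
  set x : ℝ := lam ^ (-(1 / p)) with hx
  have hxpos : 0 < x := Real.rpow_pos_of_pos hlam _
  -- Absorbs the `+1` from rounding up; the only place where the upper bound `Λ` is needed.
  have hone : 1 ≤ Λ ^ (1 / p) * x := by
    have h1 : lam ^ (1 / p) * x = 1 := by
      rw [hx, ← Real.rpow_add hlam, add_neg_cancel, Real.rpow_zero]
    exact h1.ge.trans
      (mul_le_mul_of_nonneg_right (Real.rpow_le_rpow hlam.le hlamΛ (by positivity)) hxpos.le)
  set J := ⌈x⌉₊ with hJ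
  have hJpos : 0 < J := Nat.ceil_pos.2 hxpos
  have hxJ : x ≤ J := Nat.le_ceil x
  have hJx : (J : ℝ) ≤ x + 1 := (Nat.ceil_lt_add_one hxpos.le).le
  have hx1 : x ^ (1 - p) = x * lam := by
    have h1 : x ^ (-p) = lam := by
      rw [hx, ← Real.rpow_mul hlam.le]
      rw [show -(1 / p) * -p = 1 by field_simp, Real.rpow_one]
    rw [sub_eq_add_neg, Real.rpow_add hxpos, h1, Real.rpow_one]
  have htail : ∀ n, J ≤ n → ∑ j ∈ Finset.Ico J n, s j / (s j + lam) ≤ C / (p - 1) * x := by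
    intro n hn
    calc ∑ j ∈ Finset.Ico J n, s j / (s j + lam)
        ≤ ∑ j ∈ Finset.Ico J n, C / lam * ((j : ℝ) + 1) ^ (-p) := by
          refine Finset.sum_le_sum fun j _ => ?_
          rw [div_mul_eq_mul_div]
          exact div_le_div₀ (mul_nonneg hC (Real.rpow_nonneg (by positivity) _)) (hsC j) hlam
            (by linarith [hs j])
      _ = C / lam * ∑ j ∈ Finset.Ico J n, ((j : ℝ) + 1) ^ (-p) := by rw [Finset.mul_sum]
      _ ≤ C / lam * ((J : ℝ) ^ (1 - p) / (p - 1)) := by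
          gcongr
          exact sum_Ico_rpow_neg_le hp hJpos hn
      _ ≤ C / lam * (x ^ (1 - p) / (p - 1)) := by
          refine mul_le_mul_of_nonneg_left (div_le_div_of_nonneg_right ?_ (by linarith))
            (by positivity)
          exact Real.rpow_le_rpow_of_nonpos hxpos hxJ (by linarith)
      _ = C / (p - 1) * x := by
          rw [hx1]
          field_simp
  refine ENNReal.tsum_le_of_sum_range_le fun n => ?_
  rw [← ENNReal.ofReal_sum_of_nonneg fun j _ => hterm j]
  refine ENNReal.ofReal_le_ofReal ?_
  have hsub : Finset.range n ⊆ Finset.range (max n J) :=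
    Finset.range_subset_range.2 (le_max_left _ _)
  calc ∑ j ∈ Finset.range n, s j / (s j + lam)
      ≤ ∑ j ∈ Finset.range (max n J), s j / (s j + lam) :=
        Finset.sum_le_sum_of_subset_of_nonneg hsub fun j _ _ => hterm j
    _ = ∑ j ∈ Finset.range J, s j / (s j + lam) +
        ∑ j ∈ Finset.Ico J (max n J), s j / (s j + lam) :=
        (Finset.sum_range_add_sum_Ico _ (le_max_right _ _)).symm
    _ ≤ J + C / (p - 1) * x := by
        refine add_le_add ?_ (htail _ (le_max_right _ _))
        refine (Finset.sum_le_card_nsmul _ _ 1 fun j _ => hterm1 j).trans_eq (by simp)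
    _ ≤ (1 + Λ ^ (1 / p) + C / (p - 1)) * x := by linarith

end EffectiveDimension

/-! ### Deterministic error bound for penalized least squares on the good event -/

section ErrorBound

variable {Ω : Type*} {E H : Type*} [NormedAddCommGroup E] [InnerProductSpace ℝ E]
  [NormedAddCommGroup H] [InnerProductSpace ℝ H]

theorem momentDev_eq (Z : ℕ → Ω → E) (T : E →L[ℝ] E) (m N : ℕ) (ω : Ω) (f g : E) :
    momentDev Z T m N ω f g = (1 / (N : ℝ)) * ∑ i ∈ Finset.range m, ⟪Z i ω, f⟫ * ⟪Z i ω, g⟫ -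
      (m / N : ℝ) * ⟪T f, g⟫ := by
  rw [momentDev, Finset.sum_sub_distrib, Finset.sum_const, Finset.card_range, nsmul_eq_mul]
  ring

theorem abs_le_sqrt_mul_of_sq_le {x η y z : ℝ} (hη : 0 ≤ η) (hy : 0 ≤ y) (h : x ^ 2 ≤ η * (y ^ 2 * z)) :
    |x| ≤ √η * y * √z := by
  rw [← Real.sqrt_sq_eq_abs]
  refine (Real.sqrt_le_sqrt h).trans_eq ?_
  rw [Real.sqrt_mul hη, Real.sqrt_mul (sq_nonneg y), Real.sqrt_sq hy, mul_assoc]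

/-- Here `p` is the centre of shrinkage, `βref` the population reference, and `a` the fraction of
the target curvature present in the pool. Since `hpop` annihilates the mean of the model mismatch,
only its empirical fluctuation remains. The fluctuation of the quadratic form is absorbed by half of
the curvature. -/
theorem sqrt_ridge_error_le {κ : Type*} (A : Finset κ) (Z : κ → ℕ → Ω → E) (e : κ → ℕ → Ω → ℝ)
    (T : κ → E →L[ℝ] E) (T₀ : E →L[ℝ] E) (hT₀ : ∀ g, 0 ≤ ⟪T₀ g, g⟫) (m : κ → ℕ) (N : ℕ) (ω : Ω)
    (V : H →L[ℝ] E) (hV : ∀ γ, ‖V γ‖ ≤ ‖γ‖) {βhat p βref : H} {b : κ → H} {lam a R η₁ η₂ η₃ : ℝ}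
    (hlam : 0 < lam) (ha : a ≤ 1) (hR : 0 ≤ R) (h1 : 0 ≤ η₁) (h2 : 0 ≤ η₂) (h3 : 0 ≤ η₃)
    (hnormal : ∀ γ, (1 / (N : ℝ)) * ∑ l ∈ A, ∑ i ∈ Finset.range (m l),
      (⟪Z l i ω, V (b l)⟫ + e l i ω - ⟪Z l i ω, V βhat⟫) * ⟪Z l i ω, V γ⟫ =
        lam * ⟪βhat - p, γ⟫)
    (hpop : ∀ g, ∑ l ∈ A, (m l / N : ℝ) * ⟪T l (V (b l) - V βref), g⟫ = 0)
    (hlow : ∀ g, a * ⟪T₀ g, g⟫ ≤ ∑ l ∈ A, (m l / N : ℝ) * ⟪T l g, g⟫)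
    (hgood : ∀ l ∈ A, IsGood T₀ lam (Z l) (e l) (T l) (m l) N η₁ η₂ η₃ ω)
    (hη : A.card * √η₁ ≤ a / 2) (hbR : ∀ l ∈ A, ‖V (b l) - V βref‖ ≤ R) :
    a / 2 * √(⟪T₀ (V (βhat - βref)), V (βhat - βref)⟫ + lam * ‖βhat - βref‖ ^ 2) ≤
      √lam * ‖βref - p‖ + A.card * (√η₂ * R + √η₃) := by
  set d := βhat - βref with hd
  set Q := ⟪T₀ (V d), V d⟫ + lam * ‖d‖ ^ 2 with hQ
  have hQ0 : 0 ≤ Q := add_nonneg (hT₀ _) (by positivity)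
  have hq0 : 0 ≤ regForm T₀ lam (V d) := add_nonneg (hT₀ _) (by positivity)
  have hqQ : regForm T₀ lam (V d) ≤ Q := by
    have := pow_le_pow_left₀ (norm_nonneg _) (hV d) 2
    rw [regForm, hQ]
    gcongr
  have hsq : √(regForm T₀ lam (V d)) ≤ √Q := Real.sqrt_le_sqrt hqQ
  have b1 : ∀ l ∈ A, |momentDev (Z l) (T l) (m l) N ω (V d) (V d)| ≤ √η₁ * Q := by
    intro l hl
    rw [← Real.sqrt_sq_eq_abs]
    refine (Real.sqrt_le_sqrt (hgood l hl (V d) (V d)).1).trans ?_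
    rw [Real.sqrt_mul h1, Real.sqrt_mul_self hq0]
    gcongr
  have b2 : ∀ l ∈ A, |momentDev (Z l) (T l) (m l) N ω (V (b l) - V βref) (V d)| ≤ √η₂ * R * √Q := by
    intro l hl
    refine (abs_le_sqrt_mul_of_sq_le h2 (norm_nonneg _) (hgood l hl _ (V d)).2.1).trans ?_
    have := hbR l hl
    gcongr
  have b3 : ∀ l ∈ A, |noiseDev (Z l) (e l) (m l) N ω (V d)| ≤ √η₃ * √Q := by
    intro l hl
    have := abs_le_sqrt_mul_of_sq_le (y := 1) h3 zero_le_one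
      (by simpa using (hgood l hl 0 (V d)).2.2)
    refine this.trans ?_
    rw [mul_one]
    gcongr
  have hsum : ∀ {F : κ → ℝ} {c : ℝ}, (∀ l ∈ A, |F l| ≤ c) → |∑ l ∈ A, F l| ≤ A.card * c := by
    intro F c hF
    refine (Finset.abs_sum_le_sum_abs _ _).trans ?_
    simpa using Finset.sum_le_card_nsmul _ _ _ hF
  have s1 := hsum b1
  have s2 := hsum b2
  have s3 := hsum b3
  have hlam_inner : |lam * ⟪βref - p, d⟫| ≤ √lam * ‖βref - p‖ * √Q := by
    have h4 : √lam * ‖d‖ ≤ √Q := by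
      rw [← Real.sqrt_sq (norm_nonneg d), ← Real.sqrt_mul hlam.le]
      exact Real.sqrt_le_sqrt (by rw [hQ]; linarith [hT₀ (V d)])
    rw [abs_mul, abs_of_pos hlam]
    calc lam * |⟪βref - p, d⟫| ≤ (√lam * √lam) * (‖βref - p‖ * ‖d‖) := by
          rw [Real.mul_self_sqrt hlam.le]
          gcongr
          exact abs_real_inner_le_norm _ _
      _ = √lam * ‖βref - p‖ * (√lam * ‖d‖) := by ring
      _ ≤ _ := by gcongr
  -- The normal equations tested with `γ = d`, each empirical moment being replaced by its mean plus
  -- a deviation.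
  have main : lam * ‖d‖ ^ 2 + ∑ l ∈ A, (m l / N : ℝ) * ⟪T l (V d), V d⟫ =
      -(lam * ⟪βref - p, d⟫) + ∑ l ∈ A, noiseDev (Z l) (e l) (m l) N ω (V d)
      + ∑ l ∈ A, momentDev (Z l) (T l) (m l) N ω (V (b l) - V βref) (V d)
      - ∑ l ∈ A, momentDev (Z l) (T l) (m l) N ω (V d) (V d) := by
    have hn := hnormal d
    have e0 : βhat - p = d + (βref - p) := by rw [hd]; abel
    rw [e0, inner_add_left, real_inner_self_eq_norm_sq, mul_add] at hn
    have e1 : (1 / (N : ℝ)) * ∑ l ∈ A, ∑ i ∈ Finset.range (m l),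
        (⟪Z l i ω, V (b l)⟫ + e l i ω - ⟪Z l i ω, V βhat⟫) * ⟪Z l i ω, V d⟫ =
        ∑ l ∈ A, (noiseDev (Z l) (e l) (m l) N ω (V d) +
          (1 / (N : ℝ)) * ∑ i ∈ Finset.range (m l), ⟪Z l i ω, V (b l) - V βref⟫ * ⟪Z l i ω, V d⟫ -
          (1 / (N : ℝ)) * ∑ i ∈ Finset.range (m l), ⟪Z l i ω, V d⟫ * ⟪Z l i ω, V d⟫) := by
      rw [Finset.mul_sum]
      refine Finset.sum_congr rfl fun l _ => ?_
      rw [noiseDev, ← mul_add, ← mul_sub, ← Finset.sum_add_distrib, ← Finset.sum_sub_distrib]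
      congr 1
      refine Finset.sum_congr rfl fun i _ => ?_
      have : V d = V βhat - V βref := by rw [hd, map_sub]
      rw [this, inner_sub_right, inner_sub_right]
      ring
    have e2 := hpop (V d)
    simp only [momentDev_eq, Finset.sum_sub_distrib, Finset.sum_add_distrib] at e1 ⊢
    linarith
  have hl := hlow (V d)
  -- Every error term is linear in `√Q`, except the fluctuation of the quadratic form, which `hη`
  -- limits to `a/2 * Q`. Dividing by `√Q` then finishes.
  have hfin : a / 2 * Q ≤ (√lam * ‖βref - p‖ + A.card * (√η₂ * R + √η₃)) * √Q := by
    have t1 := abs_le.1 s1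
    have t2 := abs_le.1 s2
    have t3 := abs_le.1 s3
    have t4 := abs_le.1 hlam_inner
    have t5 : (A.card : ℝ) * (√η₁ * Q) ≤ a / 2 * Q := by
      rw [← mul_assoc]
      exact mul_le_mul_of_nonneg_right hη hQ0
    have t6 : a * Q ≤ a * ⟪T₀ (V d), V d⟫ + lam * ‖d‖ ^ 2 := by
      have : 0 ≤ lam * ‖d‖ ^ 2 := by positivity
      rw [hQ]
      nlinarith
    have t7 : (√lam * ‖βref - p‖ + A.card * (√η₂ * R + √η₃)) * √Q =
      √lam * ‖βref - p‖ * √Q + A.card * (√η₂ * R * √Q) + A.card * (√η₃ * √Q) := by ring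
    rw [t7]
    linarith [t1.1, t1.2, t2.1, t2.2, t3.1, t3.2, t4.1, t4.2]
  rcases hQ0.eq_or_lt with h0 | h0
  · rw [← h0, Real.sqrt_zero, mul_zero]
    positivity
  · have hs : 0 < √Q := Real.sqrt_pos.2 h0
    refine le_of_mul_le_mul_right ?_ hs
    rwa [mul_assoc, Real.mul_self_sqrt hQ0]

end ErrorBound

/-! ### Probability of the good events under the chosen regularization. -/

section Asymptotic

variable {Ω : Type*} [MeasurableSpace Ω] {P : Measure Ω} [IsProbabilityMeasure P]
  {E : Type*} [NormedAddCommGroup E] [InnerProductSpace ℝ E] [MeasurableSpace E] [BorelSpace E]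

theorem rpow_neg_le_of_le {lam c₁ x q α : ℝ} (hc₁ : 0 < c₁) (hx : 0 < x) (hq : 0 ≤ q)
    (h : c₁ * x ^ (-α) ≤ lam) : lam ^ (-q) ≤ c₁ ^ (-q) * x ^ (α * q) := by
  have hxα : 0 < x ^ (-α) := Real.rpow_pos_of_pos hx _
  refine (Real.rpow_le_rpow_of_nonpos (mul_pos hc₁ hxα) h (neg_nonpos.2 hq)).trans_eq ?_
  rw [Real.mul_rpow hc₁.le hxα.le, ← Real.rpow_mul hx.le, neg_mul_neg]

/-- With the minimax regularization parameter, all tasks are good with high probability. -/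
theorem exists_eventually_measure_not_isGood_le {ι : Type*} {A : Finset ι} {Z : ι → ℕ → Ω → E}
    {e : ι → ℕ → Ω → ℝ} {T : ι → E →L[ℝ] E} {κ v : ℝ}
    (hZ : ∀ l ∈ A, IsTaskSample P (Z l) (e l) (T l) κ v) (hκ : 0 ≤ κ) (hv : 0 ≤ v)
    (φ : HilbertBasis ℕ ℝ E) {T₀ : E →L[ℝ] E} (hT₀ : ∀ f g, ⟪T₀ f, g⟫ = ⟪f, T₀ g⟫) {s : ℕ → ℝ}
    (hs : ∀ j, 0 < s j) (hφ : ∀ j, T₀ (φ j) = s j • φ j) (hsum : Summable s) {c : ℝ} (hc : 0 ≤ c)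
    (htc : ∀ l ∈ A, ∀ j, ⟪T l (φ j), φ j⟫ ≤ c * s j) {p C : ℝ} (hp : 1 < p) (hC : 0 ≤ C)
    (hsC : ∀ j : ℕ, s j ≤ C * ((j : ℝ) + 1) ^ (-p))
    {N : ℕ → ℕ} (hN : ∀ k, 0 < N k) (hNt : Tendsto N atTop atTop) {m : ℕ → ι → ℕ}
    (hm : ∀ k, ∀ l ∈ A, m k l ≤ N k) {lam : ℕ → ℝ} (hlam : ∀ k, 0 < lam k) {Λ c₁ : ℝ} (hΛ : 0 < Λ)
    (hlamΛ : ∀ k, lam k ≤ Λ) (hc₁ : 0 < c₁) (hlow : ∀ k, c₁ * (N k : ℝ) ^ (-(p / (p + 1))) ≤ lam k)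
    {δ η₁ : ℝ} (hδ : 0 < δ) (hη₁ : 0 < η₁) :
    ∃ M, 0 < M ∧ ∀ᶠ k in atTop, P {ω | ¬ ∀ l ∈ A, IsGood T₀ (lam k) (Z l) (e l) (T l) (m k l) (N k)
      η₁ (M * lam k) (M * lam k) ω} ≤ ENNReal.ofReal δ := by
  obtain ⟨C', hC', hdim⟩ := exists_effective_dimension_le hp hC hΛ hs hsC
  have hp0 : 0 < p := by linarith
  set D : ℕ → ℝ := fun k => C' * lam k ^ (-(1 / p)) with hD
  have hD0 : ∀ k, 0 ≤ D k := fun k => mul_nonneg hC' (Real.rpow_nonneg (hlam k).le _)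
  have hN0 : ∀ k, (0 : ℝ) < N k := fun k => by exact_mod_cast hN k
  set C'' : ℝ := C' * c₁ ^ (-(1 / p + 1)) with hC''
  have hC''0 : 0 ≤ C'' := mul_nonneg hC' (Real.rpow_nonneg hc₁.le _)
  -- The variance–bias balance: `lam ≳ N^(-p/(p+1))` is what makes the effective dimension over `N`
  -- of order `lam`.
  have hDN : ∀ k, D k / N k ≤ C'' * lam k := by
    intro k
    have h1 := rpow_neg_le_of_le (q := 1 / p + 1) hc₁ (hN0 k) (by positivity) (hlow k)
    have e1 : p / (p + 1) * (1 / p + 1) = 1 := by field_simp; ring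
    rw [e1, Real.rpow_one] at h1
    have e2 : lam k ^ (-(1 / p)) = lam k ^ (-(1 / p + 1)) * lam k := by
      rw [← Real.rpow_add_one (hlam k).ne']
      congr 1
      ring
    rw [div_le_iff₀ (hN0 k), hD, hC'']
    simp only
    rw [e2]
    calc C' * (lam k ^ (-(1 / p + 1)) * lam k)
        ≤ C' * (c₁ ^ (-(1 / p + 1)) * N k * lam k) := by
          have := (hlam k).le
          gcongr
      _ = _ := by ring
  -- `D²/N` is at most of order `N^(-(p-1)/(p+1))`, so `p > 1` permits a fixed tolerance `η₁` for
  -- the quadratic form.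
  have hD2 : Tendsto (fun k => D k ^ 2 / N k) atTop (𝓝 0) := by
    have hb : ∀ k, D k ^ 2 / N k ≤
        (C' * c₁ ^ (-(1 / p))) ^ 2 * (N k : ℝ) ^ (-((p - 1) / (p + 1))) := by
      intro k
      have h1 := rpow_neg_le_of_le (q := 1 / p) hc₁ (hN0 k) (by positivity) (hlow k)
      have e1 : p / (p + 1) * (1 / p) = 1 / (p + 1) := by field_simp
      rw [e1] at h1
      have h2 : D k ≤ C' * c₁ ^ (-(1 / p)) * (N k : ℝ) ^ (1 / (p + 1)) := by
        rw [mul_assoc]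
        exact mul_le_mul_of_nonneg_left h1 hC'
      have e2 : (N k : ℝ) ^ (-((p - 1) / (p + 1))) * N k = ((N k : ℝ) ^ (1 / (p + 1))) ^ 2 := by
        rw [← Real.rpow_add_one (hN0 k).ne', ← Real.rpow_natCast, ← Real.rpow_mul (hN0 k).le]
        congr 1
        field_simp
        push_cast
        ring
      rw [div_le_iff₀ (hN0 k), mul_assoc, e2, ← mul_pow]
      exact pow_le_pow_left₀ (hD0 k) h2 2
    have hlim : Tendsto (fun k => (C' * c₁ ^ (-(1 / p))) ^ 2 *
        (N k : ℝ) ^ (-((p - 1) / (p + 1)))) atTop (𝓝 0) := by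
      have h1 := (tendsto_rpow_neg_atTop (y := (p - 1) / (p + 1))
        (div_pos (by linarith) (by linarith))).comp (tendsto_natCast_atTop_atTop.comp hNt)
      simpa using h1.const_mul ((C' * c₁ ^ (-(1 / p))) ^ 2)
    exact squeeze_zero (fun k => div_nonneg (sq_nonneg _) (hN0 k).le) hb hlim
  set τ := ∑' j, s j with hτ
  have hτ0 : 0 ≤ τ := tsum_nonneg fun j => (hs j).le
  have hsτ : ∑' j, ENNReal.ofReal (s j) ≤ ENNReal.ofReal τ :=
    (ENNReal.ofReal_tsum_of_nonneg (fun j => (hs j).le) hsum).ge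
  set a : ℝ := (A.card : ℝ)
  have ha : 0 ≤ a := Nat.cast_nonneg _
  -- Chosen so that the mismatch and noise failures, summed over the tasks, have probability at most
  -- `δ/2`; the quadratic form takes the other half.
  set M : ℝ := 1 + 2 * a * (κ * (c * τ) * c * C'' + v * c * C'') / δ with hM
  have hM0 : 0 < M := by positivity
  refine ⟨M, hM0, ?_⟩
  have hsmall : ∀ᶠ k in atTop, a * (κ * (c * c) / η₁) * (D k ^ 2 / N k) < δ / 2 := by
    have := hD2.const_mul (a * (κ * (c * c) / η₁))
    rw [mul_zero] at this
    exact this.eventually (gt_mem_nhds (by positivity))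
  filter_upwards [hsmall] with k hk
  have hMl : 0 < M * lam k := mul_pos hM0 (hlam k)
  have hone : ∀ l ∈ A, P {ω | ¬ IsGood T₀ (lam k) (Z l) (e l) (T l) (m k l) (N k)
      η₁ (M * lam k) (M * lam k) ω} ≤ ENNReal.ofReal (κ * (c * c) / η₁ * (D k ^ 2 / N k) +
        (κ * (c * τ) * c * C'' + v * c * C'') / M) := by
    intro l hl
    refine ((hZ l hl).measure_not_isGood_le φ hT₀ hs hφ hc (htc l hl) (hlam k) (hD0 k) hτ0
      (hdim (lam k) (hlam k) (hlamΛ k)) hsτ (hN k) (hm k l hl) hη₁ hMl hMl).trans ?_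
    have hNk := hN0 k
    have hDk := hD0 k
    rw [← ENNReal.ofReal_add (by positivity) (by positivity),
      ← ENNReal.ofReal_add (by positivity) (by positivity)]
    refine ENNReal.ofReal_le_ofReal ?_
    have e1 : κ * (c * D k * (c * D k)) / N k / η₁ = κ * (c * c) / η₁ * (D k ^ 2 / N k) := by
      field_simp
    have h2 : D k / N k / (M * lam k) ≤ C'' / M := by
      rw [div_le_div_iff₀ hMl hM0]
      nlinarith [mul_le_mul_of_nonneg_right (hDN k) hM0.le]
    have e2 : κ * (c * τ * (c * D k)) / N k / (M * lam k) + v * (c * D k) / N k / (M * lam k) =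
        (κ * (c * τ) * c + v * c) * (D k / N k / (M * lam k)) := by ring
    have e3 : (κ * (c * τ) * c * C'' + v * c * C'') / M = (κ * (c * τ) * c + v * c) * (C'' / M) := by
      ring
    rw [add_assoc, e1, e2, e3]
    gcongr
  have hset : {ω | ¬ ∀ l ∈ A, IsGood T₀ (lam k) (Z l) (e l) (T l) (m k l) (N k)
      η₁ (M * lam k) (M * lam k) ω} ⊆ ⋃ l ∈ A, {ω | ¬ IsGood T₀ (lam k) (Z l) (e l) (T l) (m k l)
        (N k) η₁ (M * lam k) (M * lam k) ω} := by
    intro ω hω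
    rw [Set.mem_ofPred_eq] at hω
    push Not at hω
    obtain ⟨l, hl, h⟩ := hω
    exact Set.mem_biUnion hl h
  refine (measure_mono hset).trans ((measure_biUnion_finset_le _ _).trans ?_)
  refine (Finset.sum_le_card_nsmul _ _ _ hone).trans ?_
  rw [← ENNReal.ofReal_nsmul, nsmul_eq_mul]
  refine ENNReal.ofReal_le_ofReal ?_
  change a * _ ≤ δ
  have h5 : a * ((κ * (c * τ) * c * C'' + v * c * C'') / M) ≤ δ / 2 := by
    rw [← mul_div_assoc, div_le_iff₀ hM0, hM]
    have hx : 0 ≤ a * (κ * (c * τ) * c * C'' + v * c * C'') := by positivity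
    have : δ / 2 * (1 + 2 * a * (κ * (c * τ) * c * C'' + v * c * C'') / δ) =
        δ / 2 + a * (κ * (c * τ) * c * C'' + v * c * C'') := by field_simp
    rw [this]
    linarith
  rw [mul_add, ← mul_assoc]
  linarith

/-- Tightness of one real random variable, by continuity from above. It handles each single index to
which the asymptotics do not yet apply. -/
theorem exists_measure_gt_le {W : Ω → ℝ} (hW : AEMeasurable W P) {δ : ℝ} (hδ : 0 < δ) :
    ∃ w : ℝ, 0 ≤ w ∧ P {ω | w < W ω} ≤ ENNReal.ofReal δ := by
  have h1 : Tendsto (fun n : ℕ => P {ω | (n : ℝ) < W ω}) atTop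
      (𝓝 (P (⋂ n : ℕ, {ω | (n : ℝ) < W ω}))) := by
    refine tendsto_measure_iInter_atTop (fun n => nullMeasurableSet_lt aemeasurable_const hW) ?_
      ⟨0, measure_ne_top _ _⟩
    intro i j hij ω hω
    have h : (j : ℝ) < W ω := hω
    exact lt_of_le_of_lt (Nat.cast_le.2 hij) h
  have h2 : (⋂ n : ℕ, {ω | (n : ℝ) < W ω}) = ∅ := by
    refine Set.eq_empty_of_forall_notMem fun ω hω => ?_
    obtain ⟨n, hn⟩ := exists_nat_gt (W ω)
    exact absurd (Set.mem_iInter.1 hω n) (not_lt.2 hn.le)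
  rw [h2, measure_empty] at h1
  obtain ⟨n, hn⟩ := (h1.eventually (gt_mem_nhds (ENNReal.ofReal_pos.2 hδ))).exists
  exact ⟨n, Nat.cast_nonneg n, hn.le⟩

end Asymptotic

/-! ### The two-step estimator in whitened coordinates -/

section TwoStep

variable {Ω : Type*} {E H : Type*} [NormedAddCommGroup E] [InnerProductSpace ℝ E]
  [NormedAddCommGroup H] [InnerProductSpace ℝ H]

/-- Normal equations of penalized least squares, shrinking towards `p`, over the tasks in `A`. -/
def NormalEq {ι : Type*} (A : Finset ι) (Z : ι → ℕ → Ω → E) (e : ι → ℕ → Ω → ℝ) (m : ι → ℕ) (N : ℕ)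
    (ω : Ω) (V : H →L[ℝ] E) (b : ι → H) (lam : ℝ) (p βhat : H) : Prop :=
  ∀ γ, (1 / (N : ℝ)) * ∑ l ∈ A, ∑ i ∈ Finset.range (m l),
    (⟪Z l i ω, V (b l)⟫ + e l i ω - ⟪Z l i ω, V βhat⟫) * ⟪Z l i ω, V γ⟫ = lam * ⟪βhat - p, γ⟫

/-- A crude bound on a penalized least squares solution. -/
theorem NormalEq.norm_sq_le {ι : Type*} {A : Finset ι} {Z : ι → ℕ → Ω → E} {e : ι → ℕ → Ω → ℝ}
    {m : ι → ℕ} {N : ℕ} {ω : Ω} {V : H →L[ℝ] E} (hV : ∀ γ, ‖V γ‖ ≤ ‖γ‖) {b : ι → H} {lam : ℝ}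
    {p βhat : H} (h : NormalEq A Z e m N ω V b lam p βhat) (hlam : 0 < lam) (hN : 0 < N)
    {B w : ℝ} (hB : ∀ l ∈ A, ‖b l - p‖ ≤ B)
    (hw : ∑ l ∈ A, ∑ i ∈ Finset.range (m l), (‖Z l i ω‖ ^ 2 + e l i ω ^ 2) ≤ w) :
    ‖βhat - p‖ ^ 2 ≤ 2 * (B ^ 2 + 1) * w / lam := by
  have hn := h (βhat - p)
  rw [real_inner_self_eq_norm_sq] at hn
  rw [le_div_iff₀ hlam, mul_comm, ← hn]
  have hN1 : 1 / (N : ℝ) ≤ 1 := by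
    rw [div_le_one (by exact_mod_cast hN)]
    exact_mod_cast hN
  have hterm : ∀ l ∈ A, ∀ i ∈ Finset.range (m l),
      (⟪Z l i ω, V (b l)⟫ + e l i ω - ⟪Z l i ω, V βhat⟫) * ⟪Z l i ω, V (βhat - p)⟫ ≤
        2 * (B ^ 2 + 1) * (‖Z l i ω‖ ^ 2 + e l i ω ^ 2) := by
    intro l hl i _
    have h1 : |⟪Z l i ω, V (b l - p)⟫| ≤ ‖Z l i ω‖ * B :=
      (abs_real_inner_le_norm _ _).trans
        (mul_le_mul_of_nonneg_left ((hV _).trans (hB l hl)) (norm_nonneg _))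
    have h2 := sq_le_sq' (abs_le.1 h1).1 (abs_le.1 h1).2
    have e1 : ⟪Z l i ω, V (b l)⟫ + e l i ω - ⟪Z l i ω, V βhat⟫ =
        ⟪Z l i ω, V (b l - p)⟫ + e l i ω - ⟪Z l i ω, V (βhat - p)⟫ := by
      simp only [map_sub, inner_sub_right]
      ring
    rw [e1]
    generalize ⟪Z l i ω, V (b l - p)⟫ = x at *
    generalize ⟪Z l i ω, V (βhat - p)⟫ = y at *
    -- Completing the square, `(x + e - y) y ≤ (x + e)²/4 ≤ (x² + e²)/2`, and then `x² ≤ B² ‖Z‖²`.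
    nlinarith [sq_nonneg (x + e l i ω - 2 * y), sq_nonneg (x - e l i ω), sq_nonneg (x + e l i ω),
      sq_nonneg ‖Z l i ω‖, sq_nonneg (e l i ω), sq_nonneg B,
      mul_nonneg (sq_nonneg B) (sq_nonneg (e l i ω))]
  have hsum : ∑ l ∈ A, ∑ i ∈ Finset.range (m l),
      (⟪Z l i ω, V (b l)⟫ + e l i ω - ⟪Z l i ω, V βhat⟫) * ⟪Z l i ω, V (βhat - p)⟫ ≤
        2 * (B ^ 2 + 1) * w := by
    refine (Finset.sum_le_sum fun l hl => Finset.sum_le_sum (hterm l hl)).trans ?_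
    simp only [← Finset.mul_sum]
    exact mul_le_mul_of_nonneg_left hw (by positivity)
  have hw0 : 0 ≤ w := le_trans (Finset.sum_nonneg fun l _ => Finset.sum_nonneg fun i _ => by
    positivity) hw
  have hR : 0 ≤ 2 * (B ^ 2 + 1) * w := by positivity
  calc _ ≤ (1 / (N : ℝ)) * (2 * (B ^ 2 + 1) * w) :=
        mul_le_mul_of_nonneg_left hsum (by positivity)
    _ ≤ 1 * (2 * (B ^ 2 + 1) * w) := mul_le_mul_of_nonneg_right hN1 hR
    _ = _ := one_mul _

end TwoStep

/-! ### Risk of the two-step estimator: the good event, a fixed index, and all indices together. -/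

section TwoStepRisk

variable {Ω : Type*} {E H : Type*} [NormedAddCommGroup E] [InnerProductSpace ℝ E]
  [NormedAddCommGroup H] [InnerProductSpace ℝ H] {ι : Type*}

/-- The two-step estimator has excess risk at most `x`, for all parameters in `𝓑`. -/
def TwoStepRiskLE (A : Finset ι) (o : ι) (Z : ι → ℕ → Ω → E) (e : ι → ℕ → Ω → ℝ)
    (T₀ : E →L[ℝ] E) (V : H →L[ℝ] E) (𝓑 : Set (ι → H)) (n : ι → ℕ) (lam1 lam2 x : ℝ) (ω : Ω) :
    Prop :=
  ∀ b ∈ 𝓑, ∀ β₁ β₂ : H, NormalEq A Z e n (∑ l ∈ A, n l) ω V b lam1 0 β₁ →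
    NormalEq {o} Z e n (n o) ω V b lam2 β₁ (β₁ + β₂) →
    ⟪T₀ (V (β₁ + β₂ - b o)), V (β₁ + β₂ - b o)⟫ ≤ x

/-- On the good events of the two steps, the excess risk is of the order `lam2`. -/
theorem twoStepRiskLE_of_isGood {A : Finset ι} {o : ι} (ho : o ∈ A) {Z : ι → ℕ → Ω → E}
    {e : ι → ℕ → Ω → ℝ} {T : ι → E →L[ℝ] E} (hT : ∀ l ∈ A, ∀ g, 0 ≤ ⟪T l g, g⟫) {V : H →L[ℝ] E}
    (hV : ∀ γ, ‖V γ‖ ≤ ‖γ‖) {𝓑 : Set (ι → H)} {B : ℝ} (hB0 : 0 ≤ B)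
    (hB : ∀ b ∈ 𝓑, ∀ l ∈ A, ‖b l‖ ≤ B)
    {n : ι → ℕ} (hn : 0 < n o) {lam1 lam2 : ℝ} (hlam1 : 0 < lam1) (hlam2 : 0 < lam2)
    (hlimit : ∀ b ∈ 𝓑, ∃ βS : H, ‖βS‖ ≤ B ∧
      ∀ g, ∑ l ∈ A, ((n l : ℝ) / (∑ l ∈ A, n l : ℕ)) * ⟪T l (V (b l) - V βS), g⟫ = 0)
    {a : ℝ} (ha : 0 < a) (ha1 : a ≤ 1) (han : a * (∑ l ∈ A, n l : ℕ) ≤ n o)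
    {η₁ η₂ M₁ M₂ : ℝ} (hη₁ : 0 ≤ η₁) (hη₂ : 0 ≤ η₂) (hη₁' : A.card * √η₁ ≤ a / 2)
    (hη₂' : √η₂ ≤ 1 / 2) (hM₁ : 0 ≤ M₁) (hM₂ : 0 ≤ M₂) {ω : Ω}
    (hg₁ : ∀ l ∈ A, IsGood (T o) lam1 (Z l) (e l) (T l) (n l) (∑ l ∈ A, n l) η₁
      (M₁ * lam1) (M₁ * lam1) ω)
    (hg₂ : IsGood (T o) lam2 (Z o) (e o) (T o) (n o) (n o) η₂ (M₂ * lam2) (M₂ * lam2) ω) :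
    TwoStepRiskLE A o Z e (T o) V 𝓑 n lam1 lam2
      (lam2 * (2 * (2 * B + 2 / a * (B + A.card * (√M₁ * (2 * B) + √M₁)) + √M₂)) ^ 2) ω := by
  intro b hb β₁ β₂ h1 h2
  have hN : 0 < ∑ l ∈ A, n l := hn.trans_le (Finset.single_le_sum (fun _ _ => Nat.zero_le _) ho)
  have hN' : (0 : ℝ) < (∑ l ∈ A, n l : ℕ) := by exact_mod_cast hN
  have hn' : (0 : ℝ) < n o := by exact_mod_cast hn
  obtain ⟨βS, hβS, hpop⟩ := hlimit b hb
  have hlow : ∀ g, a * ⟪T o g, g⟫ ≤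
      ∑ l ∈ A, ((n l : ℝ) / (∑ l ∈ A, n l : ℕ)) * ⟪T l g, g⟫ := by
    intro g
    refine le_trans ?_ (Finset.single_le_sum (f := fun l =>
      ((n l : ℝ) / (∑ l ∈ A, n l : ℕ)) * ⟪T l g, g⟫) (fun l hl =>
        mul_nonneg (by positivity) (hT l hl g)) ho)
    refine mul_le_mul_of_nonneg_right ?_ (hT o ho g)
    rwa [le_div_iff₀ hN']
  have step1 := sqrt_ridge_error_le A Z e T (T o) (hT o ho) n _ ω V hV hlam1 ha1 (R := 2 * B)
    (by positivity) hη₁ (by positivity) (by positivity) h1 hpop hlow hg₁ hη₁' (fun l hl => by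
      rw [← map_sub]
      refine (hV _).trans ((norm_sub_le _ _).trans ?_)
      linarith [hB b hb l hl])
  have hs1 : 0 < √lam1 := Real.sqrt_pos.2 hlam1
  -- Only the penalty part of the error form is kept. All terms carry a factor `√lam1`, which
  -- cancels and leaves a bound independent of the sample size.
  have hd1 : ‖β₁ - βS‖ ≤ 2 / a * (B + A.card * (√M₁ * (2 * B) + √M₁)) := by
    have h4 : √lam1 * ‖β₁ - βS‖ ≤ √(⟪T o (V (β₁ - βS)), V (β₁ - βS)⟫ + lam1 * ‖β₁ - βS‖ ^ 2) := by
      rw [← Real.sqrt_sq (norm_nonneg (β₁ - βS)), ← Real.sqrt_mul hlam1.le,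
        Real.sqrt_sq (norm_nonneg (β₁ - βS))]
      exact Real.sqrt_le_sqrt (by linarith [hT o ho (V (β₁ - βS))])
    have h5 := (mul_le_mul_of_nonneg_left h4 (by positivity : 0 ≤ a / 2)).trans step1
    rw [sub_zero, Real.sqrt_mul hM₁] at h5
    have h6 : a / 2 * ‖β₁ - βS‖ ≤ B + A.card * (√M₁ * (2 * B) + √M₁) := by
      refine le_of_mul_le_mul_left ?_ hs1
      calc √lam1 * (a / 2 * ‖β₁ - βS‖) = a / 2 * (√lam1 * ‖β₁ - βS‖) := by ring
        _ ≤ _ := h5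
        _ ≤ √lam1 * B + A.card * (√M₁ * √lam1 * (2 * B) + √M₁ * √lam1) := by gcongr
        _ = _ := by ring
    rw [div_mul_eq_mul_div, le_div_iff₀ ha]
    linarith
  set R := 2 / a * (B + A.card * (√M₁ * (2 * B) + √M₁)) with hR
  have hbβ : ‖b o - β₁‖ ≤ 2 * B + R := by
    have e1 : b o - β₁ = b o - βS - (β₁ - βS) := by abel
    rw [e1]
    refine (norm_sub_le _ _).trans (add_le_add ((norm_sub_le _ _).trans ?_) hd1)
    linarith [hB b hb o ho]
  -- With the target alone the reference is the truth, so the mismatch radius is `0` and the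
  -- curvature fraction is `1`. The remaining bias is `√lam2 ‖b o - β₁‖`, bounded by the first step.
  have step2 := sqrt_ridge_error_le {o} Z e T (T o) (hT o ho) n (n o) ω V hV (βref := b o) hlam2
    le_rfl (R := 0) (η₂ := M₂ * lam2) (η₃ := M₂ * lam2) le_rfl hη₂ (by positivity) (by positivity) h2 (fun g => by simp)
    (fun g => by simp [div_self hn'.ne'])
    (fun l hl => by rw [Finset.mem_singleton.1 hl]; exact hg₂) (by simpa using hη₂')
    (fun l hl => by simp [Finset.mem_singleton.1 hl])
  simp only [Finset.card_singleton, Nat.cast_one, mul_zero, zero_add, one_mul] at step2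
  have hsq : √(⟪T o (V (β₁ + β₂ - b o)), V (β₁ + β₂ - b o)⟫ + lam2 * ‖β₁ + β₂ - b o‖ ^ 2) ≤
      √lam2 * (2 * (2 * B + R + √M₂)) := by
    rw [Real.sqrt_mul hM₂] at step2
    have : √lam2 * ‖b o - β₁‖ ≤ √lam2 * (2 * B + R) := by gcongr
    linarith
  have hQ0 : 0 ≤ ⟪T o (V (β₁ + β₂ - b o)), V (β₁ + β₂ - b o)⟫ + lam2 * ‖β₁ + β₂ - b o‖ ^ 2 :=
    add_nonneg (hT o ho _) (by positivity)
  have h7 := pow_le_pow_left₀ (Real.sqrt_nonneg _) hsq 2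
  rw [Real.sq_sqrt hQ0, mul_pow, Real.sq_sqrt hlam2.le] at h7
  have : 0 ≤ lam2 * ‖β₁ + β₂ - b o‖ ^ 2 := by positivity
  linarith

theorem TwoStepRiskLE.mono {A : Finset ι} {o : ι} {Z : ι → ℕ → Ω → E} {e : ι → ℕ → Ω → ℝ}
    {T₀ : E →L[ℝ] E} {V : H →L[ℝ] E} {𝓑 : Set (ι → H)} {n : ι → ℕ} {lam1 lam2 x y : ℝ} {ω : Ω}
    (h : TwoStepRiskLE A o Z e T₀ V 𝓑 n lam1 lam2 x ω) (hxy : x ≤ y) :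
    TwoStepRiskLE A o Z e T₀ V 𝓑 n lam1 lam2 y ω :=
  fun b hb β₁ β₂ h1 h2 => (h b hb β₁ β₂ h1 h2).trans hxy

variable [MeasurableSpace Ω] {P : Measure Ω} [IsProbabilityMeasure P]
  [MeasurableSpace E] [BorelSpace E]

/-- No rate is claimed: ridge solutions are bounded through the total energy of the data, an almost
everywhere measurable real variable and hence tight. -/
theorem exists_measure_not_twoStepRiskLE_le {A : Finset ι} {o : ι} (ho : o ∈ A)
    {Z : ι → ℕ → Ω → E} {e : ι → ℕ → Ω → ℝ} (hZ : ∀ l ∈ A, ∀ i, AEMeasurable (Z l i) P)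
    (he : ∀ l ∈ A, ∀ i, AEMeasurable (e l i) P) (T₀ : E →L[ℝ] E) {V : H →L[ℝ] E}
    (hV : ∀ γ, ‖V γ‖ ≤ ‖γ‖) {𝓑 : Set (ι → H)} {B : ℝ} (hB : ∀ b ∈ 𝓑, ∀ l ∈ A, ‖b l‖ ≤ B)
    {n : ι → ℕ} (hn : 0 < n o) {lam1 lam2 : ℝ} (hlam1 : 0 < lam1) (hlam2 : 0 < lam2)
    {δ : ℝ} (hδ : 0 < δ) :
    ∃ x, 0 ≤ x ∧ P {ω | ¬ TwoStepRiskLE A o Z e T₀ V 𝓑 n lam1 lam2 x ω} ≤ ENNReal.ofReal δ := by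
  have hW : AEMeasurable (fun ω => ∑ l ∈ A, ∑ i ∈ Finset.range (n l),
      (‖Z l i ω‖ ^ 2 + e l i ω ^ 2)) P :=
    Finset.aemeasurable_fun_sum _ fun l hl => Finset.aemeasurable_fun_sum _ fun i _ =>
      ((hZ l hl i).norm.pow_const 2).add ((he l hl i).pow_const 2)
  obtain ⟨w, hw0, hw⟩ := exists_measure_gt_le hW hδ
  set R₁ := √(2 * (B ^ 2 + 1) * w / lam1) with hR₁
  set R₂ := √(2 * ((B + R₁) ^ 2 + 1) * w / lam2) with hR₂
  refine ⟨‖T₀‖ * (R₁ + R₂ + B) ^ 2, by positivity, (measure_mono fun ω hω => ?_).trans hw⟩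
  rw [Set.mem_ofPred_eq] at hω ⊢
  by_contra hcon
  rw [not_lt] at hcon
  refine hω fun b hb β₁ β₂ h1 h2 => ?_
  have hN : 0 < ∑ l ∈ A, n l := hn.trans_le (Finset.single_le_sum (fun _ _ => Nat.zero_le _) ho)
  have k1 := h1.norm_sq_le hV hlam1 hN (B := B) (fun l hl => by simpa using hB b hb l hl) hcon
  have k1' : ‖β₁‖ ≤ R₁ := by
    rw [sub_zero] at k1
    exact Real.le_sqrt_of_sq_le k1
  have hcon2 : ∑ l ∈ ({o} : Finset ι), ∑ i ∈ Finset.range (n l),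
      (‖Z l i ω‖ ^ 2 + e l i ω ^ 2) ≤ w :=
    (Finset.sum_le_sum_of_subset_of_nonneg (Finset.singleton_subset_iff.2 ho)
      fun l _ _ => Finset.sum_nonneg fun i _ => by positivity).trans hcon
  have k2 := h2.norm_sq_le hV hlam2 hn (B := B + R₁) (fun l hl => by
    rw [Finset.mem_singleton.1 hl]
    exact (norm_sub_le _ _).trans (add_le_add (hB b hb o ho) k1')) hcon2
  have k2' : ‖β₂‖ ≤ R₂ := by
    rw [add_sub_cancel_left] at k2
    exact Real.le_sqrt_of_sq_le k2
  have k3 : ‖V (β₁ + β₂ - b o)‖ ≤ R₁ + R₂ + B := by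
    refine (hV _).trans ((norm_sub_le _ _).trans ?_)
    exact add_le_add ((norm_add_le _ _).trans (add_le_add k1' k2')) (hB b hb o ho)
  calc _ ≤ ‖T₀ (V (β₁ + β₂ - b o))‖ * ‖V (β₁ + β₂ - b o)‖ := real_inner_le_norm _ _
    _ ≤ ‖T₀‖ * ‖V (β₁ + β₂ - b o)‖ * ‖V (β₁ + β₂ - b o)‖ := by
        gcongr
        exact T₀.le_opNorm _
    _ = ‖T₀‖ * ‖V (β₁ + β₂ - b o)‖ ^ 2 := by ring
    _ ≤ _ := by gcongr

theorem exists_forall_measure_not_twoStepRiskLE_le {A : Finset ι} {o : ι} (ho : o ∈ A)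
    {Z : ι → ℕ → Ω → E} {e : ι → ℕ → Ω → ℝ} {T : ι → E →L[ℝ] E} {κ v : ℝ}
    (hZ : ∀ l ∈ A, IsTaskSample P (Z l) (e l) (T l) κ v)
    (φ : HilbertBasis ℕ ℝ E) {s : ℕ → ℝ} (hs : ∀ j, 0 < s j) (hφ : ∀ j, T o (φ j) = s j • φ j)
    (hsum : Summable s) {c : ℝ} (hc : 0 ≤ c)
    (htc : ∀ l ∈ A, ∀ j, ⟪T l (φ j), φ j⟫ ≤ c * s j) {p C : ℝ} (hp : 1 < p) (hC : 0 ≤ C)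
    (hsC : ∀ j : ℕ, s j ≤ C * ((j : ℝ) + 1) ^ (-p)) {V : H →L[ℝ] E} (hV : ∀ γ, ‖V γ‖ ≤ ‖γ‖)
    {𝓑 : Set (ι → H)} {B : ℝ} (hB0 : 0 ≤ B) (hB : ∀ b ∈ 𝓑, ∀ l ∈ A, ‖b l‖ ≤ B)
    {n : ℕ → ι → ℕ} (hn : ∀ k, 0 < n k o) (hnt : Tendsto (fun k => n k o) atTop atTop)
    {lam1 lam2 : ℕ → ℝ} (hlam1 : ∀ k, 0 < lam1 k) (hlam2 : ∀ k, 0 < lam2 k)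
    (hlimit : ∀ k, ∀ b ∈ 𝓑, ∃ βS : H, ‖βS‖ ≤ B ∧ ∀ g,
      ∑ l ∈ A, ((n k l : ℝ) / (∑ l ∈ A, n k l : ℕ)) * ⟪T l (V (b l) - V βS), g⟫ = 0)
    {a : ℝ} (ha : 0 < a) (ha1 : a ≤ 1) (han : ∀ k, a * (∑ l ∈ A, n k l : ℕ) ≤ n k o)
    {Λ₁ c₁ c₂ C₂ : ℝ} (hΛ₁ : 0 < Λ₁) (hlamΛ : ∀ k, lam1 k ≤ Λ₁) (hc₁ : 0 < c₁)
    (hlow₁ : ∀ k, c₁ * ((∑ l ∈ A, n k l : ℕ) : ℝ) ^ (-(p / (p + 1))) ≤ lam1 k)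
    (hc₂ : 0 < c₂) (hlow₂ : ∀ k, c₂ * (n k o : ℝ) ^ (-(p / (p + 1))) ≤ lam2 k)
    (hC₂ : 0 < C₂) (hupp₂ : ∀ k, lam2 k ≤ C₂ * (n k o : ℝ) ^ (-(p / (p + 1)))) {δ : ℝ}
    (hδ : 0 < δ) :
    ∃ M, 0 ≤ M ∧ ∀ k, P {ω | ¬ TwoStepRiskLE A o Z e (T o) V 𝓑 (n k) (lam1 k) (lam2 k)
      (M * (n k o : ℝ) ^ (-(p / (p + 1)))) ω} ≤ ENNReal.ofReal δ := by
  have hoZ := hZ o ho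
  have hκ := hoZ.kurtosis_nonneg
  have hv : 0 ≤ v := (integral_nonneg fun ω => sq_nonneg (e o 0 ω)).trans hoZ.variance_e
  have hn1 : ∀ k, (1 : ℝ) ≤ n k o := fun k => by exact_mod_cast hn k
  have hn0 : ∀ k, (0 : ℝ) < n k o := fun k => one_pos.trans_le (hn1 k)
  have hoN : ∀ k, n k o ≤ ∑ l ∈ A, n k l := fun k =>
    Finset.single_le_sum (f := n k) (fun _ _ => Nat.zero_le _) ho
  have hpow : ∀ k, 0 < (n k o : ℝ) ^ (-(p / (p + 1))) := fun k => Real.rpow_pos_of_pos (hn0 k) _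
  have hcard : (0 : ℝ) < A.card := by exact_mod_cast Finset.card_pos.2 ⟨o, ho⟩
  -- The tolerance `(a / (2 * A.card))²` meets `A.card * √η₁ ≤ a / 2` with equality; the single-task
  -- call below uses `(1/2)²` likewise.
  obtain ⟨M₁, hM₁, hev₁⟩ := exists_eventually_measure_not_isGood_le hZ hκ hv φ hoZ.symm hs hφ hsum
    hc htc hp hC hsC (N := fun k => ∑ l ∈ A, n k l) (fun k => (hn k).trans_le (hoN k))
    (tendsto_atTop_mono hoN hnt) (m := n)
    (fun k l hl => Finset.single_le_sum (f := n k) (fun _ _ => Nat.zero_le _) hl) hlam1 hΛ₁ hlamΛ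
    hc₁ hlow₁ (half_pos hδ) (η₁ := (a / (2 * A.card)) ^ 2) (by positivity)
  obtain ⟨M₂, hM₂, hev₂⟩ := exists_eventually_measure_not_isGood_le (A := {o})
    (fun l hl => hZ l ((Finset.mem_singleton.1 hl).symm ▸ ho)) hκ hv φ hoZ.symm hs hφ hsum
    hc (fun l hl => htc l ((Finset.mem_singleton.1 hl).symm ▸ ho)) hp hC hsC (N := fun k => n k o)
    hn hnt (m := n) (fun k l hl => by rw [Finset.mem_singleton.1 hl]) hlam2 (Λ := C₂) hC₂
    (fun k => (hupp₂ k).trans (mul_le_of_le_one_right hC₂.le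
      (Real.rpow_le_one_of_one_le_of_nonpos (hn1 k) (neg_nonpos.2 (by positivity))))) hc₂ hlow₂
    (half_pos hδ) (η₁ := (1 / 2) ^ 2) (by positivity)
  set F := (2 * (2 * B + 2 / a * (B + A.card * (√M₁ * (2 * B) + √M₁)) + √M₂)) ^ 2 with hF
  obtain ⟨k₀, hk₀⟩ := eventually_atTop.1 (hev₁.and hev₂)
  have hfix : ∀ k, ∃ x, 0 ≤ x ∧ P {ω | ¬ TwoStepRiskLE A o Z e (T o) V 𝓑 (n k) (lam1 k) (lam2 k)
      x ω} ≤ ENNReal.ofReal δ := fun k => exists_measure_not_twoStepRiskLE_le ho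
    (fun l hl => (hZ l hl).aemeasurable_Z) (fun l hl => (hZ l hl).aemeasurable_e) (T o) hV hB
    (hn k) (hlam1 k) (hlam2 k) hδ
  choose x hx0 hx using hfix
  -- The finitely many indices before `k₀` enter the constant through the ratio of their fixed-index
  -- bound to the rate.
  set y : ℕ → ℝ := fun k => x k / (n k o : ℝ) ^ (-(p / (p + 1))) with hy
  have hy0 : ∀ k, 0 ≤ y k := fun k => div_nonneg (hx0 k) (hpow k).le
  have hys : 0 ≤ ∑ k ∈ Finset.range k₀, y k := Finset.sum_nonneg fun k _ => hy0 k
  refine ⟨C₂ * F + ∑ k ∈ Finset.range k₀, y k, by positivity, fun k => ?_⟩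
  rcases lt_or_ge k k₀ with hk | hk
  · refine (measure_mono fun ω hω => ?_).trans (hx k)
    refine fun h => hω (h.mono ?_)
    have h1 : x k = y k * (n k o : ℝ) ^ (-(p / (p + 1))) := (div_mul_cancel₀ _ (hpow k).ne').symm
    rw [h1]
    refine mul_le_mul_of_nonneg_right ?_ (hpow k).le
    have h2 := Finset.single_le_sum (fun k _ => hy0 k) (Finset.mem_range.2 hk)
    have h3 : 0 ≤ C₂ * F := mul_nonneg hC₂.le (sq_nonneg _)
    linarith
  · obtain ⟨g1, g2⟩ := hk₀ k hk
    have hsum2 : ENNReal.ofReal (δ / 2) + ENNReal.ofReal (δ / 2) = ENNReal.ofReal δ := by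
      rw [← ENNReal.ofReal_add (by positivity) (by positivity), add_halves]
    refine le_trans (measure_mono fun ω hω => ?_)
      ((measure_union_le _ _).trans ((add_le_add g1 g2).trans_eq hsum2))
    by_contra hcon
    rw [Set.mem_union, not_or] at hcon
    have good₁ := not_not.1 fun h => hcon.1 h
    have good₂ := not_not.1 fun h => hcon.2 h
    refine hω ((twoStepRiskLE_of_isGood ho (fun l hl => (hZ l hl).inner_T_self_nonneg) hV hB0 hB
      (hn k) (hlam1 k) (hlam2 k) (hlimit k) ha ha1 (han k) (by positivity) (by positivity) ?_ ?_
      hM₁.le hM₂.le good₁ (good₂ o (Finset.mem_singleton_self o))).mono ?_)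
    · rw [Real.sqrt_sq (by positivity), ← div_div, mul_div_cancel₀ _ hcard.ne']
    · rw [Real.sqrt_sq (by positivity)]
    · change lam2 k * F ≤ _
      have hF0 : 0 ≤ F := by positivity
      have h4 := mul_le_mul_of_nonneg_right (hupp₂ k) hF0
      have h5 := mul_nonneg hys (hpow k).le
      linarith

end TwoStepRisk

/-! ### From the sampling model to whitened task samples. -/

section Model

variable {Ω : Type*} [MeasurableSpace Ω] {P : Measure Ω} [IsProbabilityMeasure P]
  {𝒯 : Set ℝ} {L : ℕ} {X : Fin (L + 1) → ℕ → Ω → L2 𝒯} {ε : Fin (L + 1) → ℕ → Ω → ℝ}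

theorem IsSample.inner_covOp (h𝒯 : IsCompact 𝒯) (hsample : IsSample P X ε) (l : Fin (L + 1))
    (f g : L2 𝒯) :
    ⟪covOp (P.map (X l 0)) f, g⟫ = ∫ ω, ⟪f, X l 0 ω⟫ * ⟪g, X l 0 ω⟫ ∂P := by
  have := isFiniteMeasure_leb h𝒯
  have hX := hsample.aemeasurable_X l 0
  have : Fact ((2 : ENNReal) ≠ ⊤) := ⟨by norm_num⟩
  have : IsProbabilityMeasure (P.map (X l 0)) := Measure.isProbabilityMeasure_map hX
  have hmem : MemLp id 2 (P.map (X l 0)) :=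
    (memLp_map_measure_iff aestronglyMeasurable_id hX).2 (hsample.memLp_X l)
  have hmean : (P.map (X l 0))[id] = 0 := by
    rw [integral_map hX aestronglyMeasurable_id]
    exact hsample.mean_X l
  have e1 : ⟪covOp (P.map (X l 0)) f, g⟫ = covarianceBilin (P.map (X l 0)) f g :=
    InnerProductSpace.continuousLinearMapOfBilin_apply _ _ _
  rw [e1, covarianceBilin_apply hmem, hmean]
  simp only [sub_zero]
  exact integral_map hX
    (by fun_prop : Continuous fun x : L2 𝒯 => ⟪f, x⟫ * ⟪g, x⟫).aestronglyMeasurable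

variable {H : Type*} [NormedAddCommGroup H] [InnerProductSpace ℝ H] [CompleteSpace H]
  [RKHS ℝ H 𝒯 ℝ]

/-- Self-adjointness of `L_{K^{1/2}}` moves it onto the test vector, so the kurtosis bound at
`L_{K^{1/2}} f` is the one needed at `f`. -/
theorem IsSample.exists_isTaskSample (h𝒯 : IsCompact 𝒯) (hsample : IsSample P X ε)
    (hpos : (sqrtK H : L2 𝒯 →L[ℝ] L2 𝒯).IsPositive) :
    ∃ κ v, ∀ l, IsTaskSample P (fun i ω => sqrtK H (X l i ω)) (ε l)
      (opT H (P.map (X l 0))) κ v := by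
  obtain ⟨c, hc⟩ := hsample.kurtosis
  have hsymm : ∀ l ω (f : L2 𝒯), ⟪sqrtK H (X l 0 ω), f⟫ = ⟪sqrtK H f, X l 0 ω⟫ := fun l ω f => by
    rw [hpos.inner_left_eq_inner_right, real_inner_comm]
  have hmeas : Measurable (sqrtK H : L2 𝒯 →L[ℝ] L2 𝒯) := (sqrtK H).continuous.measurable
  have hT : ∀ l, ∀ f g : L2 𝒯, ⟪opT H (P.map (X l 0)) f, g⟫ =
      ∫ ω, ⟪sqrtK H (X l 0 ω), f⟫ * ⟪sqrtK H (X l 0 ω), g⟫ ∂P := by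
    intro l f g
    have : opT H (P.map (X l 0)) f = sqrtK H (covOp (P.map (X l 0)) (sqrtK H f)) := rfl
    rw [this, hpos.inner_left_eq_inner_right, hsample.inner_covOp h𝒯]
    simp only [hsymm]
  refine ⟨max c 0, ∑ l, ∫ ω, ε l 0 ω ^ 2 ∂P, fun l => ?_⟩
  refine
    { aemeasurable_Z := fun i => hmeas.comp_aemeasurable (hsample.aemeasurable_X l i)
      aemeasurable_e := hsample.aemeasurable_noise l
      indep := fun i j hij => ?_
      indep_noise := fun i => (hsample.indep_noise l i).comp hmeas measurable_id
      identDistrib_Z := fun i => (hsample.identDistrib_X l i).comp hmeas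
      identDistrib_e := hsample.identDistrib_noise l
      inner_T := hT l
      integrable_pow_four := fun f => ?_
      kurtosis_nonneg := le_max_right _ _
      kurtosis := fun f => ?_
      memLp_e := hsample.memLp_noise l
      mean_e := hsample.mean_noise l
      variance_e := Finset.single_le_sum (f := fun l => ∫ ω, ε l 0 ω ^ 2 ∂P)
        (fun l _ => integral_nonneg fun ω => sq_nonneg _) (Finset.mem_univ l) }
  · have hij' : ((l, i) : Fin (L + 1) × ℕ) ≠ (l, j) := fun h => hij (Prod.ext_iff.1 h).2
    have hm : Measurable fun q : L2 𝒯 × ℝ => (sqrtK H q.1, q.2) :=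
      (hmeas.comp measurable_fst).prodMk measurable_snd
    exact (hsample.indep.indepFun hij').comp hm hm
  · simp only [hsymm]
    exact (hc l (sqrtK H f)).1
  · rw [hT]
    simp only [hsymm, ← sq]
    refine (hc l (sqrtK H f)).2.trans ?_
    exact mul_le_mul_of_nonneg_right (le_max_left _ _) (sq_nonneg _)

/-- Each `s j` is the second moment of a coordinate of `R X`, so Bessel bounds partial sums by `E‖R
X‖²`. Summability later forces `2r > 1`. -/
theorem summable_eigenvalues (hsample : IsSample P X ε) (l : Fin (L + 1)) {κ v : ℝ}
    {R T : L2 𝒯 →L[ℝ] L2 𝒯} (hZ : IsTaskSample P (fun i ω => R (X l i ω)) (ε l) T κ v)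
    (φ : HilbertBasis ℕ ℝ (L2 𝒯)) {s : ℕ → ℝ} (hs : ∀ j, 0 ≤ s j)
    (hφ : ∀ j, T (φ j) = s j • φ j) : Summable s := by
  have hmem : MemLp (fun ω => R (X l 0 ω)) 2 P := R.comp_memLp' (hsample.memLp_X l)
  refine summable_of_sum_le hs (c := ∫ ω, ‖R (X l 0 ω)‖ ^ 2 ∂P) fun J => ?_
  have e1 : ∀ j, s j = ∫ ω, ⟪R (X l 0 ω), φ j⟫ ^ 2 ∂P := by
    intro j
    rw [← hZ.inner_T_self, hφ, real_inner_smul_left, real_inner_self_eq_norm_sq,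
      φ.orthonormal.1 j, one_pow, mul_one]
  simp only [e1]
  rw [← integral_finsetSum _ fun j _ => (hZ.memLp_inner 0 (φ j)).integrable_sq]
  refine integral_mono (integrable_finsetSum _ fun j _ => (hZ.memLp_inner 0 (φ j)).integrable_sq)
    hmem.norm.integrable_sq fun ω => ?_
  simpa [real_inner_comm] using φ.orthonormal.sum_inner_products_le (R (X l 0 ω)) (s := J)

end Model

/-! ### TL-FLR as two ridge problems, the population limit, and the diagonal bound on source
operators. -/

section Estimator

variable {𝒯 : Set ℝ} {H : Type*} [NormedAddCommGroup H] [InnerProductSpace ℝ H]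
  [RKHS ℝ H 𝒯 ℝ] {L : ℕ}

theorem transferLoss_eq_ridgeLoss {u : L2 𝒯 → H} (hu : ∀ x (β : H), pairing x β = ⟪u x, β⟫)
    (x : Fin (L + 1) → ℕ → L2 𝒯) (y : Fin (L + 1) → ℕ → ℝ) (n : Fin (L + 1) → ℕ)
    (S : Finset (Fin (L + 1))) (lam : ℝ) :
    (transferLoss x y n S lam : H → ℝ) =
      ridgeLoss ((insert 0 S).sigma fun l => Finset.range (n l)) (fun q => u (x q.1 q.2))
        (fun q => y q.1 q.2) (1 / (size n (insert 0 S) : ℝ)) lam := by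
  funext β
  simp only [transferLoss, ridgeLoss, Finset.sum_sigma, hu]

theorem debiasLoss_eq_ridgeLoss {u : L2 𝒯 → H} (hu : ∀ x (β : H), pairing x β = ⟪u x, β⟫)
    (x : Fin (L + 1) → ℕ → L2 𝒯) (y : Fin (L + 1) → ℕ → ℝ) (n : Fin (L + 1) → ℕ)
    (lam : ℝ) (βS : H) :
    debiasLoss x y n lam βS = ridgeLoss (Finset.range (n 0)) (fun i => u (x 0 i))
        (fun i => y 0 i - pairing (x 0 i) βS) (1 / (n 0 : ℝ)) lam := by
  funext β
  simp only [debiasLoss, ridgeLoss, hu, inner_add_right, sub_sub]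

variable [CompleteSpace H]

theorem exists_pairing_eq_inner (h𝒯 : IsCompact 𝒯)
    (hK : Continuous fun p : 𝒯 × 𝒯 => scalarKernel H p.1 p.2) :
    ∃ u : L2 𝒯 → H, ∀ x β, pairing x β = ⟪u x, β⟫ := by
  obtain ⟨ι, hι⟩ := exists_embedding (H := H) h𝒯 hK
  refine ⟨fun x => ι.adjoint x, fun x β => ?_⟩
  rw [pairing_eq_inner h𝒯 hK, ← hι, ContinuousLinearMap.adjoint_inner_left]

theorem existsUnique_isTLFLR (h𝒯 : IsCompact 𝒯)
    (hK : Continuous fun p : 𝒯 × 𝒯 => scalarKernel H p.1 p.2)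
    (x : Fin (L + 1) → ℕ → L2 𝒯) (y : Fin (L + 1) → ℕ → ℝ) (n : Fin (L + 1) → ℕ)
    (S : Finset (Fin (L + 1))) {lam1 lam2 : ℝ} (hlam1 : 0 < lam1) (hlam2 : 0 < lam2) :
    ∃! p : H × H, IsTLFLR x y n S lam1 lam2 p := by
  obtain ⟨u, hu⟩ := exists_pairing_eq_inner (H := H) h𝒯 hK
  obtain ⟨β₁, h1, h1'⟩ := existsUnique_isMinOn_ridgeLoss
    ((insert 0 S).sigma fun l => Finset.range (n l)) (fun q => u (x q.1 q.2))
    (fun q => y q.1 q.2) (w := 1 / (size n (insert 0 S) : ℝ)) (by positivity) hlam1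
  obtain ⟨β₂, h2, h2'⟩ := existsUnique_isMinOn_ridgeLoss (Finset.range (n 0)) (fun i => u (x 0 i))
    (fun i => y 0 i - pairing (x 0 i) β₁) (w := 1 / (n 0 : ℝ)) (by positivity) hlam2
  refine ⟨(β₁, β₂), ⟨?_, ?_⟩, ?_⟩
  · rwa [transferLoss_eq_ridgeLoss hu]
  · rwa [debiasLoss_eq_ridgeLoss hu]
  · rintro ⟨γ₁, γ₂⟩ ⟨hg1, hg2⟩
    rw [transferLoss_eq_ridgeLoss hu] at hg1
    obtain rfl : γ₁ = β₁ := h1' γ₁ hg1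
    rw [debiasLoss_eq_ridgeLoss hu] at hg2
    rw [h2' γ₂ hg2]

/-- In terms of the sum `p.1 + p.2`, the debias step is ridge regression on the target data
shrinking towards `p.1`, so one error bound covers both steps. -/
theorem IsTLFLR.normalEq {Ω : Type*} (h𝒯 : IsCompact 𝒯)
    (hK : Continuous fun p : 𝒯 × 𝒯 => scalarKernel H p.1 p.2)
    {R : L2 𝒯 →L[ℝ] L2 𝒯} {V : H →L[ℝ] L2 𝒯}
    (hRV : ∀ x (β : H), pairing x β = ⟪R x, V β⟫) {X : Fin (L + 1) → ℕ → Ω → L2 𝒯}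
    {ε : Fin (L + 1) → ℕ → Ω → ℝ} {ω : Ω} {β : Fin (L + 1) → H} {b : H} {n : Fin (L + 1) → ℕ}
    {S : Finset (Fin (L + 1))} {lam1 lam2 : ℝ} (hlam1 : 0 < lam1) (hlam2 : 0 < lam2) {p : H × H}
    (h : IsTLFLR (fun l i => X l i ω) (response β b (fun l i => X l i ω) (fun l i => ε l i ω)) n S
      lam1 lam2 p) :
    NormalEq (insert 0 S) (fun l i ω => R (X l i ω)) ε n (∑ l ∈ insert 0 S, n l) ω V (coeffs β b)
      lam1 0 p.1 ∧
    NormalEq {0} (fun l i ω => R (X l i ω)) ε n (n 0) ω V (coeffs β b) lam2 p.1 (p.1 + p.2) := by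
  obtain ⟨u, hu⟩ := exists_pairing_eq_inner (H := H) h𝒯 hK
  obtain ⟨h1, h2⟩ := h
  rw [transferLoss_eq_ridgeLoss hu] at h1
  rw [debiasLoss_eq_ridgeLoss hu] at h2
  have s1 := isRidgeSolution_of_isMinOn (by positivity) hlam1 h1
  have s2 := isRidgeSolution_of_isMinOn (by positivity) hlam2 h2
  constructor
  · intro γ
    have := s1 γ
    simp only [Finset.sum_sigma, ← hu, response, hRV] at this
    rw [sub_zero]
    exact this
  · intro γ
    have := s2 γ
    simp only [← hu, response, hRV] at this
    rw [Finset.sum_singleton, add_sub_cancel_left, ← this]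
    congr 1
    refine Finset.sum_congr rfl fun i _ => ?_
    rw [map_add, inner_add_right]
    ring

theorem isTransferLimit_iff {V : H →L[ℝ] L2 𝒯} (hV : ∀ β : H, toL2 β = sqrtK H (V β))
    {ν : Fin (L + 1) → Measure (L2 𝒯)} {β : Fin (L + 1) → H} {b : H} {n : Fin (L + 1) → ℕ}
    {S : Finset (Fin (L + 1))} {βS : H} :
    IsTransferLimit ν β b n S βS ↔
      ∑ l ∈ insert 0 S, ((n l : ℝ) / size n (insert 0 S)) • opT H (ν l) (V βS) =
        ∑ l ∈ insert 0 S, ((n l : ℝ) / size n (insert 0 S)) • opT H (ν l) (V (coeffs β b l)) := by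
  simp only [IsTransferLimit, hV]
  rfl

theorem IsTransferLimit.sum_inner_eq_zero {V : H →L[ℝ] L2 𝒯}
    (hV : ∀ β : H, toL2 β = sqrtK H (V β))
    {ν : Fin (L + 1) → Measure (L2 𝒯)} {β : Fin (L + 1) → H} {b : H} {n : Fin (L + 1) → ℕ}
    {S : Finset (Fin (L + 1))} {βS : H} (h : IsTransferLimit ν β b n S βS) (g : L2 𝒯) :
    ∑ l ∈ insert 0 S, ((n l : ℝ) / (∑ l ∈ insert 0 S, n l : ℕ)) *
      ⟪opT H (ν l) (V (coeffs β b l) - V βS), g⟫ = 0 := by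
  have h1 := congrArg (fun f => ⟪f, g⟫) ((isTransferLimit_iff hV).1 h)
  simp only [sum_inner, real_inner_smul_left] at h1
  simp only [map_sub, inner_sub_left, mul_sub, Finset.sum_sub_distrib]
  exact sub_eq_zero.2 h1.symm

theorem exists_isTransferLimit_of_commute {V : H →L[ℝ] L2 𝒯}
    (hV : ∀ β : H, toL2 β = sqrtK H (V β)) (hVn : ∀ β, ‖V β‖ ≤ ‖β‖)
    (hVs : ∀ f, ∃ β, V β = f ∧ ‖β‖ ≤ ‖f‖) {ν : Fin (L + 1) → Measure (L2 𝒯)}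
    {S : Finset (Fin (L + 1))} (hT : ∀ l, (opT H (ν l)).IsPositive)
    (hc : ∀ l ∈ insert 0 S, ∀ l' ∈ insert 0 S, Commute (opT H (ν l)) (opT H (ν l')))
    (β : Fin (L + 1) → H) (b : H) (n : Fin (L + 1) → ℕ) :
    ∃ βS : H, IsTransferLimit ν β b n S βS ∧ ‖βS‖ ≤ ∑ l ∈ insert 0 S, ‖coeffs β b l‖ := by
  obtain ⟨g, hg, h⟩ := exists_sum_apply_eq_of_commute (insert 0 S)
    (fun l => ((n l : ℝ) / size n (insert 0 S)) • opT H (ν l))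
    (fun l _ => (hT l).smul_of_nonneg (by positivity))
    (fun l hl l' hl' => ((hc l hl l' hl').smul_left _).smul_right _)
    (fun l => V (coeffs β b l))
  obtain ⟨βS, rfl, hβS⟩ := hVs g
  exact ⟨βS, (isTransferLimit_iff hV).2 h,
    hβS.trans (hg.trans (Finset.sum_le_sum fun l _ => hVn _))⟩

/-- This is the common consequence of the two assumptions that concentration needs. In the second
case `T_l = T₀^{1/2}(I - D)T₀^{1/2}` and `‖T₀^{1/2} φ_j‖² = s_j`, so `‖I - D‖` serves as the
constant. -/
theorem exists_inner_eigen_le_of_assumption {T : Fin (L + 1) → L2 𝒯 →L[ℝ] L2 𝒯}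
    {S : Finset (Fin (L + 1))} {φ : HilbertBasis ℕ ℝ (L2 𝒯)} {s : ℕ → ℝ} (hs : ∀ j, 0 < s j)
    (hφ : ∀ j, T 0 (φ j) = s j • φ j) (h : CommutingAssumption T S φ s ∨ HSAssumption T S) :
    ∃ c, 0 ≤ c ∧ ∀ l ∈ insert 0 S, ∀ j, ⟪T l (φ j), φ j⟫ ≤ c * s j := by
  have h0 : ∀ j, ⟪T 0 (φ j), φ j⟫ = s j := fun j => by
    rw [hφ, real_inner_smul_left, real_inner_self_eq_norm_sq, φ.orthonormal.1 j, one_pow, mul_one]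
  have key : ∀ l ∈ S, ∃ c : ℝ, ∀ j, ⟪T l (φ j), φ j⟫ ≤ c * s j := by
    rcases h with h | h
    · exact h.2
    · intro l hl
      obtain ⟨D, -, hD⟩ := h l hl
      refine ⟨‖ContinuousLinearMap.id ℝ (L2 𝒯) - D‖, fun j => ?_⟩
      by_cases hQ : opSqrt (T 0) = 0
      · rw [hD, hQ]
        simpa using mul_nonneg (norm_nonneg _) (hs j).le
      · obtain ⟨hpos, hsq⟩ := opSqrt_spec _ hQ
        have e1 : ⟪T l (φ j), φ j⟫ = ⟪(ContinuousLinearMap.id ℝ (L2 𝒯) - D)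
            (opSqrt (T 0) (φ j)), opSqrt (T 0) (φ j)⟫ := by
          rw [← hpos.inner_left_eq_inner_right, hD]
          rfl
        have e2 : ‖opSqrt (T 0) (φ j)‖ ^ 2 = s j := by
          rw [← real_inner_self_eq_norm_sq, ← hpos.inner_left_eq_inner_right,
            ← ContinuousLinearMap.comp_apply, hsq, h0]
        rw [e1, ← e2, sq, ← mul_assoc]
        exact (real_inner_le_norm _ _).trans
          (mul_le_mul_of_nonneg_right (ContinuousLinearMap.le_opNorm _ _) (norm_nonneg _))
  choose! c hc using key
  have hsum : 0 ≤ ∑ l ∈ S, |c l| := Finset.sum_nonneg fun l _ => abs_nonneg _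
  refine ⟨1 + ∑ l ∈ S, |c l|, by linarith, fun l hl j => ?_⟩
  rcases Finset.mem_insert.1 hl with rfl | hl
  · rw [h0]
    nlinarith [hs j]
  · refine (hc l hl j).trans (mul_le_mul_of_nonneg_right ?_ (hs j).le)
    have h1 := Finset.single_le_sum (f := fun l => |c l|) (fun l _ => abs_nonneg _) hl
    linarith [le_abs_self (c l)]

end Estimator

/-- A nonempty `S` places `Θ(h)` inside a ball of radius `h` around a fixed source coefficient. -/
theorem exists_norm_coeffs_le {H : Type*} [NormedAddCommGroup H] {L : ℕ}
    (β : Fin (L + 1) → H) {S : Finset (Fin (L + 1))} (hS : S.Nonempty)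
    {h : ℝ} (hh : 0 ≤ h) : ∃ B, 0 ≤ B ∧ ∀ b ∈ Theta β S h, ∀ l, ‖coeffs β b l‖ ≤ B := by
  obtain ⟨l₀, hl₀⟩ := hS
  have hle : ∀ l, ‖β l‖ ≤ ∑ m, ‖β m‖ := fun l =>
    Finset.single_le_sum (f := fun m => ‖β m‖) (fun _ _ => norm_nonneg _) (Finset.mem_univ l)
  have hsum : 0 ≤ ∑ m, ‖β m‖ := (norm_nonneg _).trans (hle 0)
  refine ⟨h + ∑ m, ‖β m‖, by linarith, fun b hb l => ?_⟩
  by_cases hl : l = 0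
  · subst hl
    rw [coeffs, Function.update_self]
    have h1 := norm_add_le (b - β l₀) (β l₀)
    rw [sub_add_cancel] at h1
    linarith [hb l₀ hl₀, hle l₀]
  · rw [coeffs, Function.update_of_ne hl]
    linarith [hle l]

/-! ### From asymptotic comparisons to bounds at every index. -/

section Growth

theorem exists_le_mul_of_isBigO_atTop {f g : ℕ → ℝ} (h : f =O[atTop] g) (hf : ∀ k, 0 ≤ f k)
    (hg : ∀ k, 0 < g k) : ∃ C, 0 < C ∧ ∀ k, f k ≤ C * g k := by
  obtain ⟨C, hC, hb⟩ := bound_of_isBigO_nat_atTop h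
  refine ⟨C, hC, fun k => ?_⟩
  have := hb (hg k).ne'
  rwa [Real.norm_of_nonneg (hf k), Real.norm_of_nonneg (hg k).le] at this

theorem exists_two_sided_bound_of_isTheta_atTop {f g : ℕ → ℝ} (h : f =Θ[atTop] g)
    (hf : ∀ k, 0 < f k) (hg : ∀ k, 0 < g k) :
    ∃ c C, 0 < c ∧ 0 < C ∧ ∀ k, c * g k ≤ f k ∧ f k ≤ C * g k := by
  obtain ⟨C, hC, h1⟩ := exists_le_mul_of_isBigO_atTop h.1 (fun k => (hf k).le) hg
  obtain ⟨C', hC', h2⟩ := exists_le_mul_of_isBigO_atTop h.2 (fun k => (hg k).le) hf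
  refine ⟨C'⁻¹, C, inv_pos.2 hC', hC, fun k => ⟨?_, h1 k⟩⟩
  rw [inv_mul_le_iff₀ hC']
  exact h2 k

theorem one_lt_of_summable_of_isTheta {s : ℕ → ℝ} {p : ℝ} (hs : Summable s)
    (h : s =Θ[atTop] fun j => ((j : ℝ) + 1) ^ (-p)) : 1 < p := by
  have h1 : Summable fun j : ℕ => ((j : ℝ) + 1) ^ (-p) := summable_of_isBigO_nat hs h.2
  have h2 : Summable fun j : ℕ => (j : ℝ) ^ (-p) := by
    rw [← summable_nat_add_iff 1]
    simpa using h1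
  linarith [Real.summable_nat_rpow.1 h2]

end Growth

end TLFLR

theorem theorem1
    {Ω : Type*} [MeasurableSpace Ω] (P : Measure Ω) [IsProbabilityMeasure P]
    -- the compact domain and the RKHS `H = ℋ(K)` with continuous reproducing kernel
    (𝒯 : Set ℝ) (h𝒯 : IsCompact 𝒯)
    {H : Type*} [NormedAddCommGroup H] [InnerProductSpace ℝ H] [CompleteSpace H] [RKHS ℝ H 𝒯 ℝ]
    (hK : Continuous fun p : 𝒯 × 𝒯 => TLFLR.scalarKernel H p.1 p.2)
    -- target task `0`, sources `1, …, L`, known nonempty index set `S` of sources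
    {L : ℕ} (S : Finset (Fin (L + 1))) (hS0 : 0 ∉ S) (hS : S.Nonempty)
    -- curves, noises, and coefficient functions of the sources
    (X : Fin (L + 1) → ℕ → Ω → TLFLR.L2 𝒯) (ε : Fin (L + 1) → ℕ → Ω → ℝ)
    (hsample : TLFLR.IsSample P X ε)
    (ν : Fin (L + 1) → Measure (TLFLR.L2 𝒯)) (hν : ∀ l, ν l = P.map (X l 0))
    (β : Fin (L + 1) → H) (h : ℝ) (hh : 0 ≤ h)
    -- sample sizes `n k l` and regularization parameters along the asymptotic index `k`
    (n : ℕ → Fin (L + 1) → ℕ) (hn0 : ∀ k, 0 < n k 0) (hnS : ∀ k, 0 < TLFLR.size (n k) S)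
    (hn : Tendsto (fun k => n k 0) atTop atTop)
    (hratio : ∃ c : ℝ, 0 < c ∧ ∀ᶠ k in atTop, c ≤ (n k 0 : ℝ) / TLFLR.size (n k) S)
    (lam1 lam2 : ℕ → ℝ) (hlam1_pos : ∀ k, 0 < lam1 k) (hlam2_pos : ∀ k, 0 < lam2 k)
    (r : ℝ) (hr : 0 < r)
    (hlam1 : lam1 =Θ[atTop] fun k => (TLFLR.size (n k) S : ℝ) ^ (-(2 * r / (2 * r + 1))))
    (hlam2 : lam2 =Θ[atTop] fun k => (n k 0 : ℝ) ^ (-(2 * r / (2 * r + 1))))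
    -- eigenvalues and eigenfunctions of the target operator
    (φ : HilbertBasis ℕ ℝ (TLFLR.L2 𝒯)) (s : ℕ → ℝ) (hs : ∀ j, 0 < s j)
    (hφ : ∀ j, TLFLR.opT H (ν 0) (φ j) = s j • φ j)
    (hdecay : s =Θ[atTop] fun j => ((j : ℝ) + 1) ^ (-(2 * r)))
    -- the commuting assumption, or the Hilbert–Schmidt assumption (with `β_S ∈ ℋ(K)` bounded)
    (hassum :
      TLFLR.CommutingAssumption (fun l => TLFLR.opT H (ν l)) S φ s ∨
      (TLFLR.HSAssumption (fun l => TLFLR.opT H (ν l)) S ∧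
        ∃ B : ℝ, ∀ k, ∀ b ∈ TLFLR.Theta β S h, ∃ βS : H,
          TLFLR.IsTransferLimit ν β b (n k) S βS ∧ ‖βS‖ ≤ B)) :
    -- `β_S` exists in `ℋ(K)`
    (∀ k, ∀ b ∈ TLFLR.Theta β S h, ∃ βS : H, TLFLR.IsTransferLimit ν β b (n k) S βS) ∧
    -- the TL-FLR estimator exists and is unique
    (∀ k ω b, ∃! p : H × H, TLFLR.IsTLFLR (fun l i => X l i ω)
      (TLFLR.response β b (fun l i => X l i ω) (fun l i => ε l i ω)) (n k) S
      (lam1 k) (lam2 k) p) ∧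
    -- its excess risk is `O_P` of the rate, uniformly over `Θ(h)`
    (∀ δ : ℝ, 0 < δ → ∃ M : ℝ, ∀ k,
      P {ω | ¬ ∀ b ∈ TLFLR.Theta β S h, ∀ p : H × H,
          TLFLR.IsTLFLR (fun l i => X l i ω)
            (TLFLR.response β b (fun l i => X l i ω) (fun l i => ε l i ω)) (n k) S
            (lam1 k) (lam2 k) p →
          ∀ βS : H, TLFLR.IsTransferLimit ν β b (n k) S βS →
            TLFLR.excessRisk (ν 0) b (p.1 + p.2) ≤ M * TLFLR.rate r h (n k) S βS}
        ≤ ENNReal.ofReal δ) := by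
  obtain rfl : ν = fun l => P.map (X l 0) := funext hν
  -- the whitening map and the coisometry from `ℋ(K)` to `L²`
  have hφ0 : ∀ j, φ j ≠ 0 := fun j => φ.orthonormal.ne_zero j
  -- A positive eigenvalue rules out the fallback value `0` of `opSqrt`, so `L_{K^{1/2}}` is a true
  -- square root.
  have hTne : TLFLR.opT H (P.map (X 0 0)) ≠ 0 := fun h0 => by
    have := hφ 0
    rw [h0, zero_apply] at this
    exact smul_ne_zero (hs 0).ne' (hφ0 0) this.symm
  have hRne : (TLFLR.sqrtK H : TLFLR.L2 𝒯 →L[ℝ] TLFLR.L2 𝒯) ≠ 0 := fun h0 =>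
    hTne (by rw [TLFLR.opT, h0, ContinuousLinearMap.zero_comp])
  obtain ⟨hpos, hsq⟩ : (TLFLR.sqrtK H : TLFLR.L2 𝒯 →L[ℝ] TLFLR.L2 𝒯).IsPositive ∧
      TLFLR.sqrtK H ∘L TLFLR.sqrtK H = TLFLR.integralOp (TLFLR.scalarKernel H) :=
    TLFLR.opSqrt_spec _ hRne
  obtain ⟨κ, v, hZ⟩ := hsample.exists_isTaskSample (H := H) h𝒯 hpos
  have hinj : Function.Injective (TLFLR.sqrtK H : TLFLR.L2 𝒯 →L[ℝ] TLFLR.L2 𝒯) := by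
    refine (injective_iff_map_eq_zero _).2 fun f hf => ?_
    have h1 : TLFLR.opT H (P.map (X 0 0)) f = 0 := by
      simp only [TLFLR.opT, ContinuousLinearMap.comp_apply, hf, map_zero]
    have h2 : ∀ j, ⟪φ j, f⟫ = 0 := by
      intro j
      have h3 := (hZ 0).symm (φ j) f
      rw [h1, inner_zero_right, hφ, real_inner_smul_left] at h3
      exact (mul_eq_zero.1 h3).resolve_left (hs j).ne'
    have h4 := φ.hasSum_inner_mul_inner f f
    simp only [h2, mul_zero] at h4
    exact inner_self_eq_zero.1 (h4.unique hasSum_zero)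
  obtain ⟨V, hVn, hV, hVs⟩ := TLFLR.exists_coisometry h𝒯 hK hpos hsq hinj
  have hRV : ∀ x (γ : H), TLFLR.pairing x γ = ⟪TLFLR.sqrtK H x, V γ⟫ := fun x γ => by
    rw [TLFLR.pairing_eq_inner h𝒯 hK, hV, hpos.inner_left_eq_inner_right]
  have hTpos : ∀ l, (TLFLR.opT H (P.map (X l 0))).IsPositive := fun l =>
    (ContinuousLinearMap.isPositive_iff _).2 ⟨(hZ l).symm, (hZ l).inner_T_self_nonneg⟩
  -- bounds on coefficients and population limits
  obtain ⟨B₁, hB₁0, hB₁⟩ := TLFLR.exists_norm_coeffs_le β hS hh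
  obtain ⟨B₂, hB₂⟩ : ∃ B₂ : ℝ, ∀ k, ∀ b ∈ TLFLR.Theta β S h, ∃ βS : H,
      TLFLR.IsTransferLimit (fun l => P.map (X l 0)) β b (n k) S βS ∧ ‖βS‖ ≤ B₂ := by
    rcases hassum with hcomm | ⟨-, hB⟩
    · refine ⟨∑ _l ∈ insert 0 S, B₁, fun k b hb => ?_⟩
      obtain ⟨βS, h1, h2⟩ := TLFLR.exists_isTransferLimit_of_commute hV hVn hVs hTpos hcomm.1 β b
        (n k)
      exact ⟨βS, h1, h2.trans (Finset.sum_le_sum fun l _ => hB₁ b hb l)⟩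
    · exact hB
  refine ⟨fun k b hb => (hB₂ k b hb).imp fun _ => And.left, fun k ω b =>
    TLFLR.existsUnique_isTLFLR h𝒯 hK _ _ _ _ (hlam1_pos k) (hlam2_pos k), fun δ hδ => ?_⟩
  obtain ⟨c, hc, htc⟩ := TLFLR.exists_inner_eigen_le_of_assumption
    (T := fun l => TLFLR.opT H (P.map (X l 0))) hs hφ (hassum.imp id And.left)
  -- growth rates
  have hsum : Summable s := TLFLR.summable_eigenvalues hsample 0 (hZ 0) φ (fun j => (hs j).le) hφ
  have hp : 1 < 2 * r := TLFLR.one_lt_of_summable_of_isTheta hsum hdecay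
  obtain ⟨C, hC, hsC⟩ := TLFLR.exists_le_mul_of_isBigO_atTop hdecay.1 (fun j => (hs j).le)
    (fun j => Real.rpow_pos_of_pos (by positivity) _)
  have hn0' : ∀ k, (0 : ℝ) < n k 0 := fun k => by exact_mod_cast hn0 k
  have hnS' : ∀ k, (0 : ℝ) < TLFLR.size (n k) S := fun k => by exact_mod_cast hnS k
  have hnS1 : ∀ k, (1 : ℝ) ≤ TLFLR.size (n k) S := fun k => by exact_mod_cast hnS k
  obtain ⟨K, hKpos, hSn⟩ : ∃ K, 0 < K ∧ ∀ k, (TLFLR.size (n k) S : ℝ) ≤ K * n k 0 := by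
    refine TLFLR.exists_le_mul_of_isBigO_atTop ?_ (fun k => (hnS' k).le) hn0'
    obtain ⟨c₀, hc₀, hev⟩ := hratio
    refine IsBigO.of_bound c₀⁻¹ (hev.mono fun k hk => ?_)
    rw [le_div_iff₀ (hnS' k)] at hk
    rw [Real.norm_of_nonneg (hnS' k).le, Real.norm_of_nonneg (hn0' k).le, inv_mul_eq_div,
      le_div_iff₀ hc₀, mul_comm]
    exact hk
  have hα : 0 < 2 * r / (2 * r + 1) := by positivity
  obtain ⟨c₁, C₁, hc₁, hC₁, hl1⟩ := TLFLR.exists_two_sided_bound_of_isTheta_atTop hlam1 hlam1_pos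
    (fun k => Real.rpow_pos_of_pos (hnS' k) _)
  obtain ⟨c₂, C₂, hc₂, hC₂, hl2⟩ := TLFLR.exists_two_sided_bound_of_isTheta_atTop hlam2 hlam2_pos
    (fun k => Real.rpow_pos_of_pos (hn0' k) _)
  have hN : ∀ k, ((∑ l ∈ insert 0 S, n k l : ℕ) : ℝ) = TLFLR.size (n k) S + n k 0 := fun k => by
    rw [Finset.sum_insert hS0, Nat.cast_add, add_comm]
    rfl
  -- From `n_S ≤ K n₀`, the target makes up at least the fraction `1/(1+K)` of the pool.
  set a : ℝ := 1 / (1 + K) with ha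
  have ha0 : 0 < a := by positivity
  have ha1 : a ≤ 1 := by
    rw [ha, div_le_one (by positivity)]
    linarith
  have han : ∀ k, a * (∑ l ∈ insert 0 S, n k l : ℕ) ≤ n k 0 := fun k => by
    rw [hN, ha, div_mul_eq_mul_div, one_mul, div_le_iff₀ (by positivity)]
    linarith [hSn k]
  obtain ⟨M, hM, hrisk⟩ := TLFLR.exists_forall_measure_not_twoStepRiskLE_le
    (A := insert 0 S) (o := 0) (Finset.mem_insert_self 0 S)
    (Z := fun l i ω => TLFLR.sqrtK H (X l i ω)) (e := ε)
    (T := fun l => TLFLR.opT H (P.map (X l 0))) (fun l _ => hZ l) φ hs hφ hsum hc htc hp hC.le hsC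
    hVn (𝓑 := TLFLR.coeffs β '' TLFLR.Theta β S h) (B := max B₁ B₂) (hB₁0.trans (le_max_left _ _))
    (by
      rintro _ ⟨b, hb, rfl⟩ l -
      exact (hB₁ b hb l).trans (le_max_left _ _))
    hn0 hn hlam1_pos hlam2_pos
    (by
      rintro k _ ⟨b, hb, rfl⟩
      obtain ⟨βS, h1, h2⟩ := hB₂ k b hb
      exact ⟨βS, h2.trans (le_max_right _ _), h1.sum_inner_eq_zero hV⟩)
    ha0 ha1 han hC₁
    (fun k => (hl1 k).2.trans (mul_le_of_le_one_right hC₁.le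
      (Real.rpow_le_one_of_one_le_of_nonpos (hnS1 k) (neg_nonpos.2 hα.le)))) hc₁
    (fun k => (mul_le_mul_of_nonneg_left (Real.rpow_le_rpow_of_nonpos (hnS' k)
      (by rw [hN]; linarith [hn0' k]) (neg_nonpos.2 hα.le)) hc₁.le).trans (hl1 k).1)
    hc₂ (fun k => (hl2 k).1) hC₂ (fun k => (hl2 k).2) hδ
  refine ⟨M * a ^ (-(2 * r / (2 * r + 1))), fun k => (measure_mono fun ω hω => ?_).trans (hrisk k)⟩
  refine fun hgood => hω fun b hb p hp' βS _ => ?_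
  obtain ⟨e1, e2⟩ := hp'.normalEq h𝒯 hK hRV (hlam1_pos k) (hlam2_pos k)
  have hfin := hgood _ ⟨b, hb, rfl⟩ p.1 p.2 e1 e2
  have hrisk_eq : TLFLR.excessRisk (P.map (X 0 0)) b (p.1 + p.2) =
      ⟪TLFLR.opT H (P.map (X 0 0)) (V (p.1 + p.2 - b)), V (p.1 + p.2 - b)⟫ := by
    rw [(hZ 0).inner_T_self, TLFLR.excessRisk]
    simp only [hRV, ← inner_sub_right, ← map_sub]
    exact integral_map (hsample.aemeasurable_X 0 0)
      (by fun_prop : Continuous fun x : TLFLR.L2 𝒯 =>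
        ⟪TLFLR.sqrtK H x, V (p.1 + p.2 - b)⟫ ^ 2).aestronglyMeasurable
  have hb0 : TLFLR.coeffs β b 0 = b := Function.update_self ..
  rw [hb0] at hfin
  change TLFLR.excessRisk (P.map (X 0 0)) b (p.1 + p.2) ≤ _
  rw [hrisk_eq]
  refine hfin.trans ?_
  have hNpos : (0 : ℝ) < TLFLR.size (n k) S + n k 0 := add_pos (hnS' k) (hn0' k)
  rw [mul_assoc]
  refine mul_le_mul_of_nonneg_left ?_ hM
  have hmain : (n k 0 : ℝ) ^ (-(2 * r / (2 * r + 1))) ≤ a ^ (-(2 * r / (2 * r + 1))) *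
      ((TLFLR.size (n k) S : ℝ) + n k 0) ^ (-(2 * r / (2 * r + 1))) := by
    rw [← Real.mul_rpow ha0.le hNpos.le]
    refine Real.rpow_le_rpow_of_nonpos (mul_pos ha0 hNpos) ?_ (neg_nonpos.2 hα.le)
    rw [← hN]
    exact han k
  refine hmain.trans (mul_le_mul_of_nonneg_left ?_ (Real.rpow_nonneg ha0.le _))
  rw [TLFLR.rate]
  -- The first summand of the rate already suffices, whatever `ξ` is, including the case `‖βS‖ = 0`.
  exact le_add_of_nonneg_right (by positivity)
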